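/- Notation. For integers $1\le k<d$ let $R_{k,d}$ be the set of integer pairs $(k',d'')$ with $1\le k'\le k$, $2\le d''\le d$ and $\frac kd<\frac{k'}{d''}<1$, and let $S_{k,d}$ be the set of all sequences of pairs of positive integers $((k_0,d_0),\dots,(k_u,d_u))$, $u\ge 0$, with $(k_0,d_0)=(k,d)$, $k_j<d_j$ for all $j$, $k_0\ge\dots\ge k_u\ge1$, $d_0>\dots>d_u\ge2$ and $\frac{k_0}{d_0}<\dots<\frac{k_u}{d_u}<1$. For $\varepsilon>0$, positive integers $s$, and a family $q=(q_{k',d''})$ of nonnegative integers put $$B_{s,k,d,\varepsilon}(m,n,q)=\sum_{((k_0,d_0),\dots,(k_u,d_u))\in S_{k,d}} m^{\frac{sk_u}{sd_u-d_u+k_u}+\varepsilon}\Bigl(n^{\frac d{d-k}}\prod_{j=1}^u q_{k_j,d_j}^{\frac{d_j}{d_j-k_j}-\frac{d_{j-1}}{d_{j-1}-k_{j-1}}}\Bigr)^{\frac{(d_u-k_u)(s-1)}{sd_u-d_u+k_u}}+m+n .$$ A $k$-flat is a $k$-dimensional affine subspace of $\mathbb R^d$. A variety of degree at most $c$ in $\mathbb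 R^d$ is the common zero set of finitely many real polynomials of degree at most $c$; its dimension is the Krull dimension of its ring of polynomial functions. For a finite set $\mathcal P$ of points and a finite set $\mathcal V$ of flats, $I(\mathcal P,\mathcal V)$ is the number of pairs $(p,v)\in\mathcal P\times\mathcal V$ with $p\in v$; the incidence graph contains no $K_{s,t}$ if no $s$ distinct points of $\mathcal P$ all lie in $t$ common distinct members of $\mathcal V$. (The general incidence bound asserts that for all $s\geq 2,t,\varepsilon$ there are constants $c,C$ such that $I(\mathcal P,\mathcal V)\le C\,B_{s,k,d,\varepsilon}(m,n,q)$ for every set $\mathcal P$ of $m$ points and every set $\mathcal V$ of $n$ $k$-flats in $\mathbb R^d$ such that the incidence graph contains no $K_{s,t}$ and, for each $(k',d'')\in R_{k,d}$, every $d''$-dimensional variety of degree at most $c$ has a $k'$-dimensional intersection with at most $q_{k',d''}$ members of $\mathcal V$.) Theorem. Let $k,d,d'$ be positive integers with $\frac{d'-1}{d'}>\frac kd$ and $d'-1\le k$ (that is, $(d'-1,d')\in R_{k,d}$). Then for $s=2$ the dependence on $q_{d'-1,d'}$ cannot be removed from the bound $B_{2,k,d,\varepsilon}$ for $k$-flats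 in $\mathbb R^d$. Precisely: there exist a positive integer $t$ and $\varepsilon_0>0$ such that for all $0<\varepsilon\le\varepsilon_0$ and all constants $c\in\mathbb N$, $C\in\mathbb R$ there are a finite set $\mathcal P$ of $m$ points and a finite set $\mathcal V$ of $n$ $k$-flats in $\mathbb R^d$, a family $q$ of nonnegative integers and a $d'$-flat $F$ such that (i) the incidence graph of $\mathcal P\times\mathcal V$ contains no $K_{2,t}$; (ii) for each $(k',d'')\in R_{k,d}$, every $d''$-dimensional variety of degree at most $c$ has a $k'$-dimensional intersection with at most $q_{k',d''}$ members of $\mathcal V$; (iii) $\mathcal P\subset F$, and every member of $\mathcal V$ meets $F$ in a $(d'-1)$-flat; (iv) $I(\mathcal P,\mathcal V)>C\cdot B_{2,k,d,\varepsilon}(m,n,\tilde q)$, where $\tilde q$ is obtained from $q$ by setting $q_{d'-1,d'}$ equal to $1$ and changing nothing else. -/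

import Mathlib

noncomputable section

namespace FlatIncidence

/-- The set `R_{k,d}` of pairs `(k', d')` with `1 ≤ k' ≤ k`, `2 ≤ d' ≤ d`, `k/d < k'/d' < 1`. -/
def ratioPairs (k d : ℕ) : Set (ℕ × ℕ) :=
  {p | 1 ≤ p.1 ∧ p.1 ≤ k ∧ 2 ≤ p.2 ∧ p.2 ≤ d ∧
    (k : ℚ) / d < (p.1 : ℚ) / p.2 ∧ (p.1 : ℚ) / p.2 < 1}

/-- Significant sequences `((k₀,d₀), …, (k_u,d_u))`. All relations imposed on consecutive pairs are
transitive, so they are imposed on every two members. -/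
def IsSignificant (σ : List (ℕ × ℕ)) : Prop :=
  (∀ p ∈ σ, 1 ≤ p.1 ∧ 2 ≤ p.2 ∧ p.1 < p.2) ∧
  σ.Pairwise fun p q => q.1 ≤ p.1 ∧ q.2 < p.2 ∧ (p.1 : ℚ) / p.2 < (q.1 : ℚ) / q.2

/-- The set `S_{k,d}` of significant sequences starting with `(k,d)`. A sequence
`((k,d), (k₁,d₁), …, (k_u,d_u))` is recorded by its tail `((k₁,d₁), …, (k_u,d_u))`. -/
def significantTails (k d : ℕ) : Set (List (ℕ × ℕ)) :=
  {τ | IsSignificant ((k, d) :: τ)}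

theorem significantTails_finite (k d : ℕ) : (significantTails k d).Finite := by
  refine Set.Finite.of_finite_image (f := fun τ : List (ℕ × ℕ) => τ.toFinset)
    (((Finset.range (k + 1) ×ˢ Finset.range (d + 1)).powerset.finite_toSet).subset ?_) ?_
  · rintro _ ⟨τ, hτ, rfl⟩
    have h := (List.pairwise_cons.mp hτ.2).1
    simp only [Finset.coe_powerset, Set.mem_preimage, Set.mem_powerset_iff]
    intro p hp
    have hp' := h p (by simpa using hp)
    simp only [Finset.coe_product, Finset.coe_range, Set.mem_prod, Set.mem_Iio]
    simp only at hp'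
    omega
  · intro τ hτ τ' hτ' he
    have h₁ : τ.Pairwise fun p q => q.2 < p.2 :=
      (List.pairwise_cons.mp hτ.2).2.imp fun h => h.2.1
    have h₂ : τ'.Pairwise fun p q => q.2 < p.2 :=
      (List.pairwise_cons.mp hτ'.2).2.imp fun h => h.2.1
    have n₁ : τ.Nodup := h₁.imp fun h e => by simp [e] at h
    have n₂ : τ'.Nodup := h₂.imp fun h e => by simp [e] at h
    have hp : τ.Perm τ' := by
      have h := List.toFinset_eq_iff_perm_dedup.mp he
      rwa [n₁.dedup, n₂.dedup] at h
    exact hp.eq_of_pairwise (fun a b _ _ h h' => absurd h (by omega)) h₁ h₂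

/-- `d / (d - k)` for the pair `(k,d)`. -/
def codimWeight (p : ℕ × ℕ) : ℝ := (p.2 : ℝ) / ((p.2 : ℝ) - p.1)

/-- The term of the incidence bound that belongs to the sequence `(k,d) :: τ = ((k,d), …, (k_u,d_u))`,
`m ^ (s k_u / (s d_u - d_u + k_u) + ε) * (n ^ (d/(d-k)) *
  ∏_{j=1}^u q_{k_j,d_j} ^ (d_j/(d_j-k_j) - d_{j-1}/(d_{j-1}-k_{j-1})))
    ^ ((d_u-k_u)(s-1) / (s d_u - d_u + k_u))`. -/
def boundTerm (s k d : ℕ) (ε : ℝ) (m n : ℕ) (q : ℕ × ℕ → ℕ) (τ : List (ℕ × ℕ)) : ℝ :=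
  let l : ℕ × ℕ := τ.getLastD (k, d)
  let ku : ℝ := l.1
  let du : ℝ := l.2
  (m : ℝ) ^ (s * ku / (s * du - du + ku) + ε) *
    ((n : ℝ) ^ codimWeight (k, d) *
      ((((k, d) :: τ).zip τ).map fun e =>
        (q e.2 : ℝ) ^ (codimWeight e.2 - codimWeight e.1)).prod) ^
      ((du - ku) * (s - 1) / (s * du - du + ku))

/-- The incidence bound: the sum of the terms over `S_{k,d}`, plus `m + n`. -/
def incidenceBound (s k d : ℕ) (ε : ℝ) (m n : ℕ) (q : ℕ × ℕ → ℕ) : ℝ :=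
  (∑ τ ∈ (significantTails_finite k d).toFinset, boundTerm s k d ε m n q τ) + m + n

/-- `U ⊆ ℝ^d` is a real variety of degree at most `c`: the common zero set of finitely many real
polynomials of degree at most `c`. -/
def IsVarietyOfDegreeLE {d : ℕ} (c : ℕ) (U : Set (Fin d → ℝ)) : Prop :=
  ∃ F : Finset (MvPolynomial (Fin d) ℝ),
    (∀ f ∈ F, f.totalDegree ≤ c) ∧ U = {x | ∀ f ∈ F, MvPolynomial.eval x f = 0}

/-- The dimension of a real algebraic set: the Krull dimension of its ring of polynomial
functions. -/
def algDim {d : ℕ} (U : Set (Fin d → ℝ)) : WithBot ℕ∞ :=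
  ringKrullDim (MvPolynomial (Fin d) ℝ ⧸ MvPolynomial.vanishingIdeal ℝ U)

/-- A `k`-flat: a nonempty affine subspace of dimension `k`. -/
def IsFlat {d : ℕ} (k : ℕ) (v : AffineSubspace ℝ (Fin d → ℝ)) : Prop :=
  (v : Set (Fin d → ℝ)).Nonempty ∧ Module.finrank ℝ v.direction = k

/-- The number `I(P, V)` of incidences. -/
def incidences {d : ℕ} (P : Finset (Fin d → ℝ))
    (V : Finset (AffineSubspace ℝ (Fin d → ℝ))) : ℕ :=
  {e : (Fin d → ℝ) × AffineSubspace ℝ (Fin d → ℝ) |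
    e.1 ∈ P ∧ e.2 ∈ V ∧ e.1 ∈ e.2}.ncard

/-- The incidence graph of `P × V` contains no `K_{s,t}` (`s` points, `t` flats). -/
def NoBiclique {d : ℕ} (s t : ℕ) (P : Finset (Fin d → ℝ))
    (V : Finset (AffineSubspace ℝ (Fin d → ℝ))) : Prop :=
  ∀ A ⊆ P, ∀ B ⊆ V, A.card = s → B.card = t → ∃ p ∈ A, ∃ v ∈ B, p ∉ v

/-- For each `(k',d') ∈ R_{k,d}`, every `d'`-dimensional variety of degree at most `c` has a
`k'`-dimensional intersection with at most `q_{k',d'}` members of `V`. -/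
def IntersectionCondition {d : ℕ} (k c : ℕ) (q : ℕ × ℕ → ℕ)
    (V : Finset (AffineSubspace ℝ (Fin d → ℝ))) : Prop :=
  ∀ p ∈ ratioPairs k d, ∀ U : Set (Fin d → ℝ), IsVarietyOfDegreeLE c U →
    algDim U = (p.2 : WithBot ℕ∞) →
    {v | v ∈ V ∧ algDim ((v : Set (Fin d → ℝ)) ∩ U) = (p.1 : WithBot ℕ∞)}.ncard ≤ q p

end FlatIncidence

end

/-!
Write `k = a + r` with `a = d' - 1` and `d = a + (r + g + 1)`. The points form an integer grid in a
`(a + 1)`-flat `F`, and `n = p² X` hyperplanes of `F` carry many of them. The slopes of a hyperplane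
are the powers of a parameter modulo a prime `p`; since a nonzero polynomial of degree `a` has at
most `a` roots modulo `p`, two points share at most `a` of these hyperplanes.

Each hyperplane section is extended to a `k`-flat by `r + 1` directions outside `F`, cut out by `g`
linear forms taken from a Vandermonde family, any few of which are independent. The forms are chosen
by base-`G` digits of the index of the flat, with `G ^ (g + 1)` about `n`. Suppose that a variety
`U` of bounded degree meets more than `O(G ^ g)`, that is about `n ^ (g / (g + 1))`, of the flats in
dimension `k' > a`, and choose a `k'`-dimensional component of each of these intersections. By
independence few of the forms vanish on a given component, so products of the forms of other flats
separate many of the components, and the Hilbert function of `U` exceeds what its dimension allows.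

With `p ≈ X ^ K` and `K` large there are about `X ^ (K + a + 1)` points, `X ^ (2 K + 1)` flats and
`X ^ (2 K + a + 1)` incidences. Once `q_{a,a+1}` is replaced by `1`, every term of the bound is
smaller by a fixed power of `X`.
-/

noncomputable section

namespace FlatIncidence

open MvPolynomial

theorem ringKrullDim_eq_of_isIntegral (R S : Type*) [CommRing R] [CommRing S] [Algebra R S]
    [Algebra.IsIntegral R S] [FaithfulSMul R S] : ringKrullDim S = ringKrullDim R := by
  apply le_antisymm
  · refine Order.krullDim_le_of_strictMono (PrimeSpectrum.comap (algebraMap R S)) fun p q h => ?_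
    exact Ideal.IsIntegral.comap_lt_comap (R := R) (I := p.asIdeal) (J := q.asIdeal) h
  · refine iSup_le fun l => ?_
    obtain ⟨Q, hQ, hQ'⟩ : Nonempty (Ideal.primesOver (RelSeries.head l).asIdeal S) :=
      inferInstance
    obtain ⟨L, hL, -, -⟩ := Ideal.exists_ltSeries_of_hasGoingUp l Q
    exact hL ▸ Order.LTSeries.length_le_krullDim L

theorem ringKrullDim_eq_trdeg (K A : Type*) [Field K] [CommRing A] [IsDomain A] [Algebra K A]
    [Algebra.FiniteType K A] :
    ringKrullDim A = (Cardinal.toNat (Algebra.trdeg K A) : ℕ∞) := by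
  obtain ⟨n, φ, hφ, hint⟩ := exists_integral_inj_algHom_of_fg K A
  algebraize [φ.toRingHom]
  have : FaithfulSMul (MvPolynomial (Fin n) K) A :=
    (faithfulSMul_iff_algebraMap_injective _ _).2 hφ
  have : IsScalarTower K (MvPolynomial (Fin n) K) A :=
    .of_algebraMap_eq fun r => (φ.commutes r).symm
  have htrdeg := lift_trdeg_add_eq K (MvPolynomial (Fin n) K) A
  rw [MvPolynomial.trdeg_of_isDomain,
    trdeg_eq_zero (R := MvPolynomial (Fin n) K) (A := A)] at htrdeg
  have hn : Cardinal.toNat (Algebra.trdeg K A) = n := by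
    simpa using (congrArg Cardinal.toNat htrdeg).symm
  rw [hn, ringKrullDim_eq_of_isIntegral (MvPolynomial (Fin n) K) A,
    MvPolynomial.ringKrullDim_of_isNoetherianRing, ringKrullDim_eq_zero_of_field, zero_add,
    Nat.card_fin]
  rfl

theorem exists_finset_isTranscendenceBasis {K A σ : Type*} [Finite σ] [Field K] [CommRing A]
    [IsDomain A] [Algebra K A] {x : σ → A} (hx : Algebra.adjoin K (Set.range x) = ⊤) :
    ∃ S : Finset σ, IsTranscendenceBasis K fun j : S => x j := by
  have : Algebra.IsAlgebraic (Algebra.adjoin K (Set.range x)) A := by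
    refine ⟨fun y => ?_⟩
    have hy : y ∈ Algebra.adjoin K (Set.range x) := hx ▸ Algebra.mem_top
    exact isAlgebraic_algebraMap (⟨y, hy⟩ : Algebra.adjoin K (Set.range x))
  obtain ⟨t, ht, hbasis⟩ := exists_isTranscendenceBasis_subset (R := K) (Set.range x)
  obtain ⟨s, -, hs⟩ := Set.exists_subset_bijOn (x ⁻¹' t) x
  rw [Set.image_preimage_eq_of_subset ht] at hs
  let S : Finset σ := s.toFinite.toFinset
  have hmem : ∀ j, j ∈ S ↔ j ∈ s := fun j => Set.Finite.mem_toFinset _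
  let e : S ≃ t := (Equiv.subtypeEquivRight hmem).trans hs.equiv
  have hcomp : ((↑) : t → A) ∘ e = fun j : S => x j := rfl
  exact ⟨S, hcomp ▸ (isTranscendenceBasis_equiv e).2 hbasis⟩

theorem adjoin_range_mk_X {σ K : Type*} [Field K] (P : Ideal (MvPolynomial σ K)) :
    Algebra.adjoin K (Set.range fun j => Ideal.Quotient.mk P (MvPolynomial.X j)) = ⊤ := by
  have h := congrArg (Subalgebra.map (Ideal.Quotient.mkₐ K P))
    (MvPolynomial.adjoin_range_X (R := K) (σ := σ))
  rwa [AlgHom.map_adjoin, Algebra.map_top,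
    (AlgHom.range_eq_top _).2 (Ideal.Quotient.mkₐ_surjective K P), ← Set.range_comp] at h

theorem exists_coordinates_isTranscendenceBasis {σ K : Type*} [Finite σ] [Field K]
    (P : Ideal (MvPolynomial σ K)) [P.IsPrime] :
    ∃ S : Finset σ, ringKrullDim (MvPolynomial σ K ⧸ P) = (S.card : ℕ∞) ∧
      IsTranscendenceBasis K fun j : S => Ideal.Quotient.mk P (MvPolynomial.X (j : σ)) := by
  obtain ⟨S, hS⟩ := exists_finset_isTranscendenceBasis (adjoin_range_mk_X P)
  refine ⟨S, ?_, hS⟩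
  have hcard := congrArg Cardinal.toNat hS.lift_cardinalMk_eq_trdeg
  rw [Cardinal.toNat_lift, Cardinal.toNat_lift] at hcard
  rw [ringKrullDim_eq_trdeg K, ← hcard]
  simp

section HilbertFunction

variable {σ K : Type*} [Field K]

/-- The affine Hilbert function of the ideal `J`: the dimension of the space of polynomials of
degree at most `N`, taken modulo `J`. -/
def hilbertFn (J : Ideal (MvPolynomial σ K)) (N : ℕ) : ℕ :=
  Module.finrank K ((restrictTotalDegree σ K N).map (Ideal.Quotient.mkₐ K J).toLinearMap)

theorem linearIndependent_mk_iff {ι : Type*} [Fintype ι] {J : Ideal (MvPolynomial σ K)}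
    {u : ι → MvPolynomial σ K} :
    (LinearIndependent K fun i => Ideal.Quotient.mk J (u i)) ↔
      ∀ c : ι → K, ∑ i, c i • u i ∈ J → ∀ i, c i = 0 := by
  have hsum (c : ι → K) : ∑ i, c i • Ideal.Quotient.mk J (u i) =
      Ideal.Quotient.mk J (∑ i, c i • u i) := by
    simp only [← Ideal.Quotient.mkₐ_eq_mk K, map_sum, map_smul]
  simp only [Fintype.linearIndependent_iff, hsum, Ideal.Quotient.eq_zero_iff_mem]

theorem mem_vanishingIdeal_iff_eval {A : Set (σ → K)} {p : MvPolynomial σ K} :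
    p ∈ vanishingIdeal K A ↔ ∀ x ∈ A, eval x p = 0 := by
  simp_rw [← MvPolynomial.coe_aeval_eq_eval]
  rfl

theorem linearIndependent_mk_vanishingIdeal_iff {ι : Type*} [Finite ι] {A : Set (σ → K)}
    {u : ι → MvPolynomial σ K} :
    (LinearIndependent K fun i => Ideal.Quotient.mk (vanishingIdeal K A) (u i)) ↔
      Submodule.span K ((fun a i => eval a (u i)) '' A) = ⊤ := by
  have := Fintype.ofFinite ι
  have heval (c : ι → K) (a : σ → K) :
      eval a (∑ i, c i • u i) = Fintype.linearCombination K c fun i => eval a (u i) := by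
    simp [Fintype.linearCombination_apply, smul_eval, mul_comm]
  simp only [linearIndependent_mk_iff, mem_vanishingIdeal_iff_eval, heval]
  classical
  constructor
  · intro h
    by_contra hspan
    obtain ⟨φ, hφ, hle⟩ := Submodule.exists_le_ker_of_lt_top _ (lt_top_iff_ne_top.2 hspan)
    have hrep : Fintype.linearCombination K (fun i => φ (Pi.single i 1)) = φ := by
      ext i
      simp
    refine hφ (LinearMap.pi_ext' fun i => LinearMap.ext_ring ?_)
    exact h _ (fun a ha => hrep ▸ hle (Submodule.subset_span ⟨a, ha, rfl⟩)) i
  · intro hspan c hc i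
    have hker : (⊤ : Submodule K (ι → K)) ≤ LinearMap.ker (Fintype.linearCombination K c) := by
      rw [← hspan, Submodule.span_le]
      rintro _ ⟨a, ha, rfl⟩
      exact hc a ha
    simpa using hker (Submodule.mem_top (x := Pi.single i 1))

variable {J : Ideal (MvPolynomial σ K)} {N : ℕ}

theorem exists_linearIndependent_mk_of_le_hilbertFn {M : ℕ} (h : M ≤ hilbertFn J N) :
    ∃ u : Fin M → MvPolynomial σ K, (∀ i, (u i).totalDegree ≤ N) ∧
      LinearIndependent K fun i => Ideal.Quotient.mk J (u i) := by
  obtain ⟨w, hw⟩ := exists_linearIndependent_of_le_finrank h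
  choose u hu huw using fun i => (w i).2
  refine ⟨u, fun i => (mem_restrictTotalDegree _ _ _).1 (hu i), ?_⟩
  have hmk : (fun i => Ideal.Quotient.mk J (u i)) = Submodule.subtype _ ∘ w := funext huw
  exact hmk ▸ hw.map' _ (Submodule.ker_subtype _)

variable [Finite σ]

theorem card_le_hilbertFn {ι : Type*} [Fintype ι] {u : ι → MvPolynomial σ K}
    (hdeg : ∀ i, (u i).totalDegree ≤ N)
    (hu : LinearIndependent K fun i => Ideal.Quotient.mk J (u i)) :
    Fintype.card ι ≤ hilbertFn J N := by
  let w : ι → (restrictTotalDegree σ K N).map (Ideal.Quotient.mkₐ K J).toLinearMap := fun i =>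
    ⟨Ideal.Quotient.mk J (u i),
      Submodule.mem_map_of_mem ((mem_restrictTotalDegree _ _ _).2 (hdeg i))⟩
  have hw : LinearIndependent K w := .of_comp (Submodule.subtype _) hu
  exact hw.fintype_card_le_finrank

theorem hilbertFn_add_finrank_inf (J : Ideal (MvPolynomial σ K)) (N : ℕ) :
    hilbertFn J N + Module.finrank K
        (restrictTotalDegree σ K N ⊓ J.restrictScalars K : Submodule K (MvPolynomial σ K)) =
      Module.finrank K (restrictTotalDegree σ K N) := by
  set W := restrictTotalDegree σ K N
  set f := (Ideal.Quotient.mkₐ K J).toLinearMap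
  have hker : LinearMap.ker f = J.restrictScalars K := by
    ext x
    simp [f, Ideal.Quotient.eq_zero_iff_mem]
  have h := (f.domRestrict W).finrank_range_add_finrank_ker
  rw [LinearMap.range_domRestrict, LinearMap.ker_domRestrict,
    ← Submodule.finrank_map_subtype_eq, Submodule.map_comap_subtype, hker] at h
  exact h

theorem hilbertFn_anti {I J : Ideal (MvPolynomial σ K)} (h : I ≤ J) (N : ℕ) :
    hilbertFn J N ≤ hilbertFn I N := by
  have hI := hilbertFn_add_finrank_inf I N
  have hJ := hilbertFn_add_finrank_inf J N
  have hmono : Module.finrank K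
        (restrictTotalDegree σ K N ⊓ I.restrictScalars K : Submodule K (MvPolynomial σ K)) ≤
      Module.finrank K
        (restrictTotalDegree σ K N ⊓ J.restrictScalars K : Submodule K (MvPolynomial σ K)) :=
    Submodule.finrank_mono (inf_le_inf_left _ h)
  omega

theorem hilbertFn_inf_le (I J : Ideal (MvPolynomial σ K)) (N : ℕ) :
    hilbertFn (I ⊓ J) N ≤ hilbertFn I N + hilbertFn J N := by
  have hI := hilbertFn_add_finrank_inf I N
  have hJ := hilbertFn_add_finrank_inf J N
  have hIJ := hilbertFn_add_finrank_inf (I ⊓ J) N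
  set W := restrictTotalDegree σ K N
  have hdim := Submodule.finrank_sup_add_finrank_inf_eq
    (W ⊓ I.restrictScalars K) (W ⊓ J.restrictScalars K)
  have hsup : Module.finrank K (W ⊓ I.restrictScalars K ⊔ W ⊓ J.restrictScalars K :
      Submodule K (MvPolynomial σ K)) ≤ Module.finrank K W :=
    Submodule.finrank_mono (sup_le inf_le_left inf_le_left)
  have hinf : (W ⊓ I.restrictScalars K) ⊓ (W ⊓ J.restrictScalars K) =
      W ⊓ (I ⊓ J).restrictScalars K :=
    (inf_inf_distrib_left W (I.restrictScalars K) (J.restrictScalars K)).symm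
  rw [hinf] at hdim
  omega

theorem hilbertFn_top (N : ℕ) : hilbertFn (⊤ : Ideal (MvPolynomial σ K)) N = 0 := by
  have h := hilbertFn_add_finrank_inf (⊤ : Ideal (MvPolynomial σ K)) N
  rw [Submodule.restrictScalars_top, inf_top_eq] at h
  omega

theorem hilbertFn_finset_inf_le {ι : Type*} (s : Finset ι) (J : ι → Ideal (MvPolynomial σ K))
    (N : ℕ) : hilbertFn (s.inf J) N ≤ ∑ i ∈ s, hilbertFn (J i) N := by
  classical
  induction s using Finset.induction_on with
  | empty => simp [hilbertFn_top]
  | insert i s hi ih =>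
    rw [Finset.inf_insert, Finset.sum_insert hi]
    exact (hilbertFn_inf_le _ _ _).trans (by gcongr)

end HilbertFunction

section Reduction

variable {σ K : Type*} [Field K] {J : Ideal (MvPolynomial σ K)} {S : Finset σ} {T : ℕ}

theorem mk_mem_span_reduced_monomials
    (hred : ∀ j ∉ S, ∃ r : MvPolynomial σ K, r.totalDegree < T ∧ X j ^ T - r ∈ J)
    {N : ℕ} {f : MvPolynomial σ K} (hf : f.totalDegree ≤ N) :
    Ideal.Quotient.mk J f ∈ Submodule.span K ((fun b => Ideal.Quotient.mk J (monomial b 1)) ''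
      {b : σ →₀ ℕ | b.degree ≤ N ∧ ∀ j ∉ S, b j < T}) := by
  induction N using Nat.strong_induction_on generalizing f with | h N ih => ?_
  rw [f.as_sum, map_sum]
  refine Submodule.sum_mem _ fun b hb => ?_
  have hbN : b.degree ≤ N := (le_totalDegree hb).trans hf
  by_cases hbox : ∀ j ∉ S, b j < T
  · have hsmul : Ideal.Quotient.mk J (monomial b (coeff b f)) =
        coeff b f • Ideal.Quotient.mk J (monomial b 1) := by
      rw [← Ideal.Quotient.mkₐ_eq_mk K, ← map_smul, smul_monomial, smul_eq_mul, mul_one]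
    exact hsmul ▸ Submodule.smul_mem _ _ (Submodule.subset_span ⟨b, ⟨hbN, hbox⟩, rfl⟩)
  · push Not at hbox
    obtain ⟨j, hj, hTj⟩ := hbox
    obtain ⟨r, hr, hrJ⟩ := hred j hj
    obtain ⟨b', rfl⟩ := exists_add_of_le (Finsupp.single_le_iff.2 hTj)
    set a := coeff (Finsupp.single j T + b') f
    have hmk : Ideal.Quotient.mk J (monomial (Finsupp.single j T + b') a) =
        Ideal.Quotient.mk J (monomial b' a * r) := by
      rw [Ideal.Quotient.eq, add_comm, monomial_add_single, ← mul_sub]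
      exact J.mul_mem_left _ hrJ
    have hlow : (monomial b' a * r).totalDegree < N := by
      have hmon : (monomial b' a).totalDegree ≤ b'.degree := totalDegree_monomial_le b' a
      have hmul := totalDegree_mul (monomial b' a) r
      rw [map_add, Finsupp.degree_single] at hbN
      omega
    rw [hmk]
    refine Submodule.span_mono (Set.image_mono fun b hb => ?_) (ih _ hlow le_rfl)
    exact ⟨hb.1.trans hlow.le, hb.2⟩

theorem hilbertFn_le_of_pow_reduction [Fintype σ]
    (hred : ∀ j ∉ S, ∃ r : MvPolynomial σ K, r.totalDegree < T ∧ X j ^ T - r ∈ J)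
    (hT : 1 ≤ T) (N : ℕ) : hilbertFn J N ≤ T ^ Fintype.card σ * (N + 1) ^ S.card := by
  classical
  let box : Finset (σ →₀ ℕ) :=
    Finset.univ.finsupp fun j => Finset.range (if j ∈ S then N + 1 else T)
  have hbox : {b : σ →₀ ℕ | b.degree ≤ N ∧ ∀ j ∉ S, b j < T} ⊆ box := by
    rintro b ⟨hbN, hbT⟩
    refine Finset.mem_coe.2 (Finset.mem_finsupp_iff.2 ⟨Finset.subset_univ _, fun j _ => ?_⟩)
    rw [Finset.mem_range]
    split_ifs with hj
    · exact Nat.lt_succ_of_le ((Finsupp.le_degree j b).trans hbN)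
    · exact hbT j hj
  have hle : (restrictTotalDegree σ K N).map (Ideal.Quotient.mkₐ K J).toLinearMap ≤
      Submodule.span K (box.image fun b => Ideal.Quotient.mk J (monomial b 1)) := by
    rintro _ ⟨f, hf, rfl⟩
    rw [Finset.coe_image]
    exact Submodule.span_mono (Set.image_mono hbox)
      (mk_mem_span_reduced_monomials hred ((mem_restrictTotalDegree _ _ _).1 hf))
  calc hilbertFn J N
      ≤ Module.finrank K (Submodule.span K
          (box.image fun b => Ideal.Quotient.mk J (monomial b 1) : Set (MvPolynomial σ K ⧸ J))) :=
        Submodule.finrank_mono hle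
    _ ≤ box.card := (finrank_span_finset_le_card _).trans Finset.card_image_le
    _ = ∏ j, (if j ∈ S then N + 1 else T) := by simp [box, Finset.card_finsupp]
    _ = (N + 1) ^ S.card * T ^ Sᶜ.card := by
        simp [Finset.prod_ite, Finset.filter_notMem_eq_sdiff, Finset.compl_eq_univ_sdiff]
    _ ≤ T ^ Fintype.card σ * (N + 1) ^ S.card := by
        rw [mul_comm]
        gcongr
        exact Finset.card_le_univ _

end Reduction

section IsolatedZeros

open Filter Topology

theorem exists_isLocalMinOn_add_mul_near_isolated_zero {X : Type*} [MetricSpace X] [ProperSpace X]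
    {f h : X → ℝ} (hfc : Continuous f) (hhc : Continuous h) (hf : ∀ y, 0 ≤ f y) (hh : ∀ y, 0 ≤ h y)
    {T W : Set X} (hT : IsClosed T) {a : X} (haT : a ∈ T) (ha : f a = 0)
    (hiso : ∀ᶠ y in 𝓝 a, y ∈ T → f y = 0 → y = a) (hW : W ∈ 𝓝 a) :
    ∀ᶠ ε in 𝓝[>] (0 : ℝ), ∃ y ∈ W ∩ T, IsLocalMinOn (fun z => f z + ε * h z) T y := by
  obtain ⟨ρ, hρ, hball⟩ := Metric.nhds_basis_closedBall.mem_iff.1 (inter_mem hiso hW)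
  have hsphere : ∀ y ∈ Metric.sphere a ρ ∩ T, 0 < f y := by
    rintro y ⟨hy, hyT⟩
    refine (hf y).lt_of_ne' fun h0 => ?_
    rw [(hball (Metric.sphere_subset_closedBall hy)).1 hyT h0, Metric.mem_sphere, dist_self] at hy
    exact hρ.ne hy
  obtain ⟨η, hη, hle⟩ :=
    ((isCompact_sphere a ρ).inter_right hT).exists_forall_le' hfc.continuousOn hsphere
  have hsmall : ∀ᶠ ε in 𝓝[>] (0 : ℝ), ε * h a < η := by
    have hlim : Tendsto (fun ε : ℝ => ε * h a) (𝓝 0) (𝓝 0) := by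
      simpa using (continuous_mul_const (h a)).tendsto 0
    exact (hlim.mono_left nhdsWithin_le_nhds).eventually_lt_const hη
  filter_upwards [hsmall, self_mem_nhdsWithin] with ε hε hε0
  have haK : a ∈ Metric.closedBall a ρ ∩ T := ⟨Metric.mem_closedBall_self hρ.le, haT⟩
  obtain ⟨y, hy, hmin⟩ := ((isCompact_closedBall a ρ).inter_right hT).exists_isMinOn ⟨a, haK⟩
    (hfc.add (hhc.const_mul ε)).continuousOn
  have hyball : y ∈ Metric.ball a ρ := by
    refine lt_of_le_of_ne (Metric.mem_closedBall.1 hy.1) fun heq => ?_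
    have hya : f y + ε * h y ≤ f a + ε * h a := hmin haK
    linarith [hle y ⟨heq, hy.2⟩, mul_nonneg (le_of_lt hε0) (hh y)]
  refine ⟨y, ⟨(hball hy.1).2, hy.2⟩, ?_⟩
  filter_upwards [inter_mem_nhdsWithin T (Metric.isOpen_ball.mem_nhds hyball)] with z hz
  exact hmin ⟨Metric.ball_subset_closedBall hz.2, hz.1⟩

variable {σ : Type*}

theorem hasDerivAt_eval_update [DecidableEq σ] (f : MvPolynomial σ ℝ) (y : σ → ℝ) (j : σ)
    (t : ℝ) : HasDerivAt (fun s => eval (Function.update y j s) f)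
      (eval (Function.update y j t) (pderiv j f)) t := by
  induction f using MvPolynomial.induction_on with
  | C a => simpa using hasDerivAt_const t a
  | add p q hp hq =>
    simp only [map_add]
    exact hp.add hq
  | mul_X p i hp =>
    have hX : HasDerivAt (fun s => Function.update y j s i)
        (eval (Function.update y j t) (pderiv j (X i))) t := by
      rcases eq_or_ne i j with rfl | hij
      · simpa using hasDerivAt_id' t
      · simpa [hij, pderiv_X_of_ne hij] using hasDerivAt_const t (y i)
    simp only [Derivation.leibniz, smul_eq_mul, map_add, map_mul, eval_X]
    exact (hp.mul hX).congr_deriv (by ring)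

theorem totalDegree_pderiv_le {R : Type*} [CommSemiring R] (f : MvPolynomial σ R) (j : σ) :
    (pderiv j f).totalDegree ≤ f.totalDegree := by
  conv_lhs => rw [f.as_sum, map_sum]
  refine totalDegree_finsetSum_le fun b hb => ?_
  rw [pderiv_monomial]
  exact (totalDegree_monomial_le _ _).trans
    ((Finsupp.degree_mono tsub_le_self).trans (le_totalDegree hb))

theorem eval_pderiv_eq_zero_of_isLocalMinOn {F : MvPolynomial σ ℝ} {S : Set σ} {y : σ → ℝ}
    (hy : IsLocalMinOn (fun z => eval z F) {z | S.EqOn z y} y) {j : σ} (hj : j ∉ S) :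
    eval y (pderiv j F) = 0 := by
  classical
  have hline : Tendsto (Function.update y j) (𝓝 (y j)) (𝓝[{z | S.EqOn z y}] y) := by
    refine tendsto_nhdsWithin_iff.2 ⟨?_, .of_forall fun s i hi => ?_⟩
    · have hcont : Continuous (Function.update y j) := continuous_const.update j continuous_id
      simpa using hcont.tendsto (y j)
    · exact Function.update_of_ne (ne_of_mem_of_not_mem hi hj) _ _
  rw [← Function.update_eq_self j y] at hy
  have hmin : IsLocalMin (fun s => eval (Function.update y j s) F) (y j) :=
    IsMinFilter.comp_tendsto (f := fun z => eval z F) hy (by simpa using hline)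
  simpa using hmin.hasDerivAt_eq_zero (hasDerivAt_eval_update F y j (y j))

/-- The zeros of `f` that are isolated among the zeros with the same coordinates in `S`. -/
def fiberIsolatedZeros (f : MvPolynomial σ ℝ) (S : Set σ) : Set (σ → ℝ) :=
  {a | eval a f = 0 ∧ ∀ᶠ y in 𝓝 a, S.EqOn y a → eval y f = 0 → y = a}

theorem exists_critical_near_fiberIsolatedZero [Finite σ] {f h : MvPolynomial σ ℝ}
    (hf : ∀ y, 0 ≤ eval y f) (hh : ∀ y, 0 ≤ eval y h) {S : Set σ} {a : σ → ℝ}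
    (ha : a ∈ fiberIsolatedZeros f S) {W : Set (σ → ℝ)} (hW : W ∈ 𝓝 a) :
    ∀ᶠ ε : ℝ in 𝓝[>] 0, ∃ y ∈ W, ∀ j ∉ S, eval y (pderiv j (f + C ε * h)) = 0 := by
  have := Fintype.ofFinite σ
  have hT : IsClosed {z : σ → ℝ | S.EqOn z a} := by
    simp only [Set.EqOn, Set.ofPred_forall]
    exact isClosed_biInter fun j _ => isClosed_eq (continuous_apply j) continuous_const
  filter_upwards [exists_isLocalMinOn_add_mul_near_isolated_zero (MvPolynomial.continuous_eval f)
    (MvPolynomial.continuous_eval h) hf hh hT (Set.eqOn_refl a S) ha.1 ha.2 hW]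
    with ε ⟨y, ⟨hyW, hyT⟩, hy⟩
  refine ⟨y, hyW, fun j hj => eval_pderiv_eq_zero_of_isLocalMinOn ?_ hj⟩
  have hfib : {z | S.EqOn z y} = {z : σ → ℝ | S.EqOn z a} :=
    Set.ext fun z => ⟨fun hz => hz.trans hyT, fun hz => hz.trans hyT.symm⟩
  simpa [hfib] using hy

theorem exists_pow_sub_mem_vanishingIdeal_of_critical [Fintype σ] [DecidableEq σ]
    {f : MvPolynomial σ ℝ} {c : ℕ}
    (hdeg : f.totalDegree ≤ 2 * c) {S : Finset σ} {ε : ℝ} (hε : 0 < ε) {Y : Set (σ → ℝ)}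
    (hY : ∀ y ∈ Y, ∀ j ∉ S, eval y (pderiv j (f + C ε * ∑ i ∈ Sᶜ, X i ^ (2 * c + 2))) = 0)
    {j : σ} (hj : j ∉ S) :
    ∃ r : MvPolynomial σ ℝ, r.totalDegree < 2 * c + 1 ∧
      X j ^ (2 * c + 1) - r ∈ vanishingIdeal ℝ Y := by
  set b : ℝ := ε * (2 * c + 2 : ℕ)
  have hb : b ≠ 0 := by positivity
  have hpderiv : pderiv j (∑ i ∈ Sᶜ, X i ^ (2 * c + 2) : MvPolynomial σ ℝ) =
      C ((2 * c + 2 : ℕ) : ℝ) * X j ^ (2 * c + 1) := by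
    rw [map_sum, Finset.sum_eq_single_of_mem j (by simpa using hj) fun i _ hij => by
      rw [pderiv_pow, pderiv_X_of_ne hij, mul_zero]]
    rw [pderiv_pow, pderiv_X_self, mul_one, map_natCast]
    rfl
  refine ⟨C (-b⁻¹) * pderiv j f, ?_, mem_vanishingIdeal_iff_eval.2 fun y hy => ?_⟩
  · have hmul := totalDegree_mul (C (-b⁻¹)) (pderiv j f)
    have hle := totalDegree_pderiv_le f j
    rw [totalDegree_C] at hmul
    omega
  · have hcrit : eval y (pderiv j f) + b * y j ^ (2 * c + 1) = 0 := by
      have h0 := hY y hy j hj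
      rw [map_add, pderiv_C_mul, hpderiv] at h0
      simpa only [map_add, map_mul, eval_C, map_pow, eval_X, mul_assoc, b] using h0
    simp only [map_sub, map_mul, map_pow, eval_X, eval_C]
    field_simp
    linarith

theorem exists_linearIndependent_comp_of_span_image_eq_top {K ι X : Type*} [Field K] [Finite ι]
    {w : X → ι → K} {A : Set X} (hA : Submodule.span K (w '' A) = ⊤) :
    ∃ x : ι → X, (∀ i, x i ∈ A) ∧ LinearIndependent K fun i => w (x i) := by
  obtain ⟨t, htA, hspan, ht⟩ := exists_linearIndependent K (w '' A)
  let B : Module.Basis t K (ι → K) := .mk ht (by rw [Subtype.range_coe, hspan, hA])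
  let e := (Pi.basisFun K ι).indexEquiv B
  choose x hx hwx using fun i => htA (e i).2
  have hcomp : (fun i => w (x i)) = ((↑) : t → ι → K) ∘ e := funext hwx
  exact ⟨x, hx, hcomp ▸ ht.comp e e.injective⟩

theorem exists_nhds_forall_linearIndependent {ι κ X : Type*} [Finite ι] [Finite κ]
    [TopologicalSpace X]
    {w : X → κ → ℝ} (hw : Continuous w) {x : ι → X} (hx : LinearIndependent ℝ fun i => w (x i)) :
    ∃ s : ι → Set X, (∀ i, s i ∈ 𝓝 (x i)) ∧
      ∀ y : ι → X, (∀ i, y i ∈ s i) → LinearIndependent ℝ fun i => w (y i) := by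
  have := Fintype.ofFinite κ
  have hcont : Continuous fun (y : ι → X) i => w (y i) :=
    continuous_pi fun i => hw.comp (continuous_apply i)
  have hev := (hcont.tendsto x).eventually hx.eventually
  rw [nhds_pi] at hev
  obtain ⟨I, s, hs, hsub⟩ := Filter.mem_pi'.1 hev
  exact ⟨s, hs, fun y hy => hsub fun i _ => hy i⟩

/-- If the bound failed, finitely many isolated zeros would witness it. Perturbing `f` moves them
to nearby critical points of `f + ε ∑ X_j ^ (2c + 2)`, on which all high powers of the
coordinates outside `S` reduce to lower degree. -/
theorem hilbertFn_fiberIsolatedZeros_le [Fintype σ] {f : MvPolynomial σ ℝ} {c : ℕ}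
    (hf : ∀ y, 0 ≤ eval y f) (hdeg : f.totalDegree ≤ 2 * c) (S : Finset σ) (N : ℕ) :
    hilbertFn (vanishingIdeal ℝ (fiberIsolatedZeros f S)) N ≤
      (2 * c + 1) ^ Fintype.card σ * (N + 1) ^ S.card := by
  classical
  by_contra hlarge
  obtain ⟨u, hu, hind⟩ := exists_linearIndependent_mk_of_le_hilbertFn (not_le.1 hlarge)
  obtain ⟨x, hx, hxind⟩ := exists_linearIndependent_comp_of_span_image_eq_top
    (linearIndependent_mk_vanishingIdeal_iff.1 hind)
  obtain ⟨s, hs, hsind⟩ := exists_nhds_forall_linearIndependent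
    (continuous_pi fun i => MvPolynomial.continuous_eval (u i)) hxind
  have hnonneg : ∀ y, 0 ≤ eval y (∑ i ∈ Sᶜ, X i ^ (2 * c + 2) : MvPolynomial σ ℝ) := fun y => by
    simp only [map_sum, map_pow, eval_X]
    exact Finset.sum_nonneg fun i _ => Even.pow_nonneg (by simp [parity_simps]) _
  have hcrit := eventually_all.2 fun i =>
    exists_critical_near_fiberIsolatedZero hf hnonneg (hx i) (hs i)
  obtain ⟨ε, hε, hε0⟩ := (hcrit.and self_mem_nhdsWithin).exists
  choose y hys hycrit using hε
  have hred := fun j (hj : j ∉ S) => exists_pow_sub_mem_vanishingIdeal_of_critical (j := j)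
    hdeg hε0 (Set.forall_mem_range.2 hycrit) hj
  have hyind : LinearIndependent ℝ fun i =>
      Ideal.Quotient.mk (vanishingIdeal ℝ (Set.range y)) (u i) := by
    rw [linearIndependent_mk_vanishingIdeal_iff, ← Set.range_comp]
    exact (hsind y hys).span_eq_top_of_card_eq_finrank' (by simp)
  have hcard := (card_le_hilbertFn hu hyind).trans
    (hilbertFn_le_of_pow_reduction hred (Nat.le_add_left 1 _) N)
  rw [Fintype.card_fin] at hcard
  omega

end IsolatedZeros

section VarietyHilbert

open Filter Topology

theorem exists_ne_zero_eval₂_aeval_eq_zero {K A ι : Type*} [Field K] [CommRing A] [IsDomain A]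
    [Algebra K A] {x : ι → A} (hx : IsTranscendenceBasis K x) (y : A) :
    ∃ q : Polynomial (MvPolynomial ι K), q ≠ 0 ∧ q.eval₂ (aeval x : _ →ₐ[K] A).toRingHom y = 0 := by
  obtain ⟨q, hq0, hq⟩ := hx.isAlgebraic.isAlgebraic y
  let e := hx.1.aevalEquiv
  refine ⟨q.map (e.symm : _ →+* _), ?_, ?_⟩
  · rwa [Ne, Polynomial.map_eq_zero_iff e.symm.injective]
  · rw [Polynomial.eval₂_map, ← hq, Polynomial.aeval_def]
    congr 1
    ext r
    obtain ⟨p, rfl⟩ := e.surjective r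
    simp [e, hx.1.algebraMap_aevalEquiv]

theorem aeval_mk_X {σ K : Type*} [Field K] (P : Ideal (MvPolynomial σ K)) (S : Set σ)
    (p : MvPolynomial S K) :
    aeval (fun i : S => Ideal.Quotient.mk P (X (i : σ))) p =
      Ideal.Quotient.mk P (rename (↑) p) := by
  have h : aeval (fun i : S => Ideal.Quotient.mk P (X (i : σ))) =
      (Ideal.Quotient.mkₐ K P).comp (rename (↑)) := by
    ext i
    simp
  rw [h]
  rfl

variable {σ : Type*}

theorem eventually_eq_of_eval_eval₂_eq_zero {S : Set σ} (q : Polynomial (MvPolynomial S ℝ)) (j : σ)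
    {x : σ → ℝ} (hx : eval (fun i : S => x i) q.leadingCoeff ≠ 0) :
    ∀ᶠ y in 𝓝 x, S.EqOn y x →
      eval y (q.eval₂ (rename (R := ℝ) ((↑) : S → σ)).toRingHom (X j)) = 0 → y j = x j := by
  set g : Polynomial ℝ := q.map (eval fun i : S => x i)
  have hg : g ≠ 0 := fun h0 => hx (by
    simpa [g] using congrArg (fun r => Polynomial.coeff r q.natDegree) h0)
  have hnear : ∀ᶠ t in 𝓝 (x j), t ∉ {t | g.IsRoot t} \ {x j} :=
    (((Polynomial.finite_setOfPred_isRoot hg).subset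
      Set.sdiff_subset).isClosed.isOpen_compl).mem_nhds (by simp)
  filter_upwards [(continuous_apply j).continuousAt.eventually hnear] with y hy hyS hyq
  by_contra hne
  refine hy ⟨?_, hne⟩
  have hcomp : (eval y).comp (rename (R := ℝ) ((↑) : S → σ)).toRingHom =
      eval fun i : S => x i := by
    have hyx : y ∘ ((↑) : S → σ) = fun i : S => x i := funext fun i => hyS i.2
    exact hyx ▸ RingHom.ext fun p => eval_rename _ _ p
  rw [Polynomial.hom_eval₂, eval_X, hcomp] at hyq
  exact (Polynomial.eval_map _ _).trans hyq

theorem exists_notMem_forall_coordinate_isolated (P : Ideal (MvPolynomial σ ℝ)) [P.IsPrime]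
    {S : Set σ} (hS : IsTranscendenceBasis ℝ fun j : S => Ideal.Quotient.mk P (X (j : σ)))
    (j : σ) :
    ∃ l ∉ P, ∀ x, eval x l ≠ 0 →
      ∀ᶠ y in 𝓝 x, S.EqOn y x → (∀ p ∈ P, eval y p = 0) → y j = x j := by
  obtain ⟨q, hq0, hq⟩ := exists_ne_zero_eval₂_aeval_eq_zero hS (Ideal.Quotient.mk P (X j))
  refine ⟨rename (↑) q.leadingCoeff, fun hmem => ?_, fun x hx => ?_⟩
  · rw [← Ideal.Quotient.eq_zero_iff_mem, ← aeval_mk_X] at hmem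
    exact hq0 (Polynomial.leadingCoeff_eq_zero.1 (algebraicIndependent_iff.1 hS.1 _ hmem))
  · have hqP : q.eval₂ (rename (R := ℝ) ((↑) : S → σ)).toRingHom (X j) ∈ P := by
      rw [← Ideal.Quotient.eq_zero_iff_mem, Polynomial.hom_eval₂, ← hq]
      congr 1
      exact RingHom.ext fun p => (aeval_mk_X P S p).symm
    rw [eval_rename] at hx
    filter_upwards [eventually_eq_of_eval_eval₂_eq_zero q j hx] with y hy hyS hyP
    exact hy hyS (hyP _ hqP)

theorem exists_notMem_forall_mul_mem {R : Type*} [CommRing R] [IsNoetherianRing R] {I P : Ideal R}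
    (hI : I.IsRadical) (hP : P ∈ I.minimalPrimes) : ∃ G ∉ P, ∀ g ∈ P, g * G ∈ I := by
  have hcolon : I.colon {(1 : R)} = I := by
    ext
    simp [Submodule.mem_colon_singleton]
  obtain ⟨G, rfl⟩ := Submodule.exists_eq_colon_of_mem_minimalPrimes (hcolon.symm ▸ hP)
  have hmem (g : R) : g ∈ I.colon {G} ↔ g * G ∈ I := Submodule.mem_colon_singleton
  refine ⟨G, fun hG => hP.1.1.ne_top ?_, fun g => (hmem g).1⟩
  have hGI : G ∈ I := hI ⟨2, by simpa [sq] using (hmem G).1 hG⟩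
  exact (Ideal.eq_top_iff_one _).2 ((hmem 1).2 (by simpa using hGI))

theorem isRadical_vanishingIdeal (A : Set (σ → ℝ)) :
    (vanishingIdeal ℝ A : Ideal (MvPolynomial σ ℝ)).IsRadical := by
  rintro p ⟨n, hn⟩
  rw [mem_vanishingIdeal_iff_eval] at hn ⊢
  exact fun x hx => eq_zero_of_pow_eq_zero (n := n) (by simpa using hn x hx)

theorem iInf_vanishingIdeal_fiberIsolatedZeros_le [Finite σ] (f : MvPolynomial σ ℝ) {δ : ℕ}
    (hdim : ringKrullDim (MvPolynomial σ ℝ ⧸ vanishingIdeal ℝ {x | eval x f = 0}) ≤ (δ : ℕ∞)) :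
    ⨅ (S : Finset σ) (_ : S.card ≤ δ), vanishingIdeal ℝ (fiberIsolatedZeros f S) ≤
      vanishingIdeal ℝ {x | eval x f = 0} := by
  have := Fintype.ofFinite σ
  intro p hp
  simp only [Ideal.mem_iInf, mem_vanishingIdeal_iff_eval] at hp
  have hI := isRadical_vanishingIdeal {x | eval x f = 0}
  rw [← hI.radical, ← Ideal.sInf_minimalPrimes, Ideal.mem_sInf]
  intro P hP
  have hprime : P.IsPrime := hP.1.1
  obtain ⟨S, hcard, hS⟩ := exists_coordinates_isTranscendenceBasis P
  have hSδ : S.card ≤ δ := by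
    have hle := ringKrullDim_le_of_surjective _ (Ideal.Quotient.factor_surjective hP.1.2)
    rw [hcard] at hle
    exact_mod_cast hle.trans hdim
  obtain ⟨G, hGP, hG⟩ := exists_notMem_forall_mul_mem hI hP
  choose l hlP hl using exists_notMem_forall_coordinate_isolated P (S := S) hS
  -- A zero of `f` where `G` and all `l j` are nonzero is isolated in its fiber over `S`.
  have hvanish : p * (G * ∏ j, l j) ∈ P := by
    refine hP.1.2 (mem_vanishingIdeal_iff_eval.2 fun x hx => ?_)
    by_contra hne
    simp only [map_mul, map_prod, mul_eq_zero, Finset.prod_eq_zero_iff, Finset.mem_univ, true_and,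
      not_or, not_exists] at hne
    refine hne.1 (hp S hSδ x ⟨hx, ?_⟩)
    filter_upwards [(MvPolynomial.continuous_eval G).continuousAt.eventually_ne hne.2.1,
      eventually_all.2 fun j => hl j x (hne.2.2 j)] with y hyG hy hyS hyf
    refine funext fun j => hy j hyS fun g hg => ?_
    have hgG := mem_vanishingIdeal_iff_eval.1 (hG g hg) y hyf
    rw [map_mul] at hgG
    exact (mul_eq_zero.1 hgG).resolve_right hyG
  refine (hprime.mem_or_mem hvanish).resolve_right fun h => ?_
  obtain ⟨j, -, hj⟩ := hprime.prod_mem_iff.1 ((hprime.mem_or_mem h).resolve_left hGP)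
  exact hlP j hj

theorem hilbertFn_zeros_le [Fintype σ] {f : MvPolynomial σ ℝ} {c δ : ℕ} (hf : ∀ y, 0 ≤ eval y f)
    (hdeg : f.totalDegree ≤ 2 * c)
    (hdim : ringKrullDim (MvPolynomial σ ℝ ⧸ vanishingIdeal ℝ {x | eval x f = 0}) ≤ (δ : ℕ∞))
    (N : ℕ) :
    hilbertFn (vanishingIdeal ℝ {x | eval x f = 0}) N ≤
      2 ^ Fintype.card σ * ((2 * c + 1) ^ Fintype.card σ * (N + 1) ^ δ) := by
  let T : Finset (Finset σ) := {S | S.card ≤ δ}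
  let A : Finset σ → Ideal (MvPolynomial σ ℝ) := fun S => vanishingIdeal ℝ (fiberIsolatedZeros f S)
  have hle : T.inf A ≤ vanishingIdeal ℝ {x | eval x f = 0} := by
    refine le_trans ?_ (iInf_vanishingIdeal_fiberIsolatedZeros_le f hdim)
    exact le_iInf₂ fun S hS => Finset.inf_le (by simpa [T] using hS)
  calc hilbertFn (vanishingIdeal ℝ {x | eval x f = 0}) N
      ≤ hilbertFn (T.inf A) N := hilbertFn_anti hle N
    _ ≤ ∑ S ∈ T, hilbertFn (A S) N := hilbertFn_finset_inf_le _ _ _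
    _ ≤ ∑ S ∈ T, (2 * c + 1) ^ Fintype.card σ * (N + 1) ^ δ := by
        refine Finset.sum_le_sum fun S hS =>
          (hilbertFn_fiberIsolatedZeros_le hf hdeg S N).trans ?_
        gcongr
        · omega
        · exact (Finset.mem_filter.1 hS).2
    _ ≤ 2 ^ Fintype.card σ * ((2 * c + 1) ^ Fintype.card σ * (N + 1) ^ δ) := by
        rw [Finset.sum_const, smul_eq_mul]
        gcongr
        exact (Finset.card_filter_le _ _).trans (by simp)

theorem hilbertFn_variety_le {d c δ : ℕ} {U : Set (Fin d → ℝ)} (hU : IsVarietyOfDegreeLE c U)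
    (hdim : algDim U ≤ (δ : ℕ∞)) (N : ℕ) :
    hilbertFn (vanishingIdeal ℝ U) N ≤ 2 ^ d * ((2 * c + 1) ^ d * (N + 1) ^ δ) := by
  obtain ⟨F, hF, rfl⟩ := hU
  have hzeros : {x : Fin d → ℝ | ∀ g ∈ F, eval x g = 0} = {x | eval x (∑ g ∈ F, g ^ 2) = 0} := by
    ext x
    simp only [Set.mem_ofPred_eq, map_sum, map_pow]
    rw [Finset.sum_eq_zero_iff_of_nonneg fun _ _ => sq_nonneg _]
    simp
  rw [hzeros] at hdim ⊢
  have hdeg : (∑ g ∈ F, g ^ 2).totalDegree ≤ 2 * c := totalDegree_finsetSum_le fun g hg =>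
    (totalDegree_pow _ _).trans (Nat.mul_le_mul_left 2 (hF g hg))
  simpa using hilbertFn_zeros_le (fun y => by simpa using F.sum_nonneg fun g _ => sq_nonneg _)
    hdeg hdim N

end VarietyHilbert

section Separation

variable {R σ ι K : Type*} [CommRing R] [Field K]

theorem exists_isPrime_le_ringKrullDim (I : Ideal R) {n : ℕ}
    (h : (n : WithBot ℕ∞) ≤ ringKrullDim (R ⧸ I)) :
    ∃ P : Ideal R, P.IsPrime ∧ I ≤ P ∧ (n : WithBot ℕ∞) ≤ ringKrullDim (R ⧸ P) := by
  rw [ringKrullDim_quotient] at h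
  obtain ⟨l, hl⟩ := Order.le_krullDim_iff.1 h
  refine ⟨(RelSeries.head l).1.asIdeal, (RelSeries.head l).1.2, (RelSeries.head l).2, ?_⟩
  rw [ringKrullDim_quotient]
  exact Order.le_krullDim_iff.2
    ⟨⟨l.length, fun i => ⟨(l i).1, LTSeries.head_le l i⟩, fun i => l.step i⟩, hl⟩

theorem exists_monomials_linearIndependent [Finite σ] (P : Ideal (MvPolynomial σ K)) [P.IsPrime]
    {n : ℕ} (hP : (n : WithBot ℕ∞) ≤ ringKrullDim (MvPolynomial σ K ⧸ P)) (L : ℕ) :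
    ∃ u : (Fin n → Fin (L + 1)) → MvPolynomial σ K, (∀ b, (u b).totalDegree ≤ n * L) ∧
      LinearIndependent K fun b => Ideal.Quotient.mk P (u b) := by
  obtain ⟨S, hS, hb⟩ := exists_coordinates_isTranscendenceBasis P
  have hn : n ≤ S.card := by rw [hS] at hP; exact_mod_cast hP
  obtain ⟨v⟩ : Nonempty (Fin n ↪ S) := Function.Embedding.nonempty_of_card_le (by simpa using hn)
  have hind := hb.1.comp v v.injective
  let m : (Fin n → Fin (L + 1)) → (Fin n →₀ ℕ) := fun b =>
    Finsupp.equivFunOnFinite.symm fun i => (b i : ℕ)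
  have hm : Function.Injective m := fun b b' h =>
    funext fun i => Fin.ext (by simpa [m] using DFunLike.congr_fun h i)
  refine ⟨fun b => rename (fun i => (v i : σ)) (monomial (m b) 1), fun b => ?_, ?_⟩
  · refine (totalDegree_rename_le _ _).trans ((totalDegree_monomial_le _ _).trans ?_)
    rw [Finsupp.sum_fintype _ _ (by simp)]
    simpa [m] using Finset.sum_le_card_nsmul Finset.univ (fun i => (b i : ℕ)) L
      fun i _ => Nat.le_of_lt_succ (b i).2
  · have hcomp : (Ideal.Quotient.mkₐ K P).comp (rename fun i => (v i : σ)) =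
        aeval ((fun j : S => Ideal.Quotient.mk P (X (j : σ))) ∘ v) := by
      ext i
      simp
    have hinj : Function.Injective
        ((Ideal.Quotient.mkₐ K P).comp (rename fun i => (v i : σ))) := by
      rw [hcomp]
      exact algebraicIndependent_iff_injective_aeval.1 hind
    exact ((basisMonomials (Fin n) K).linearIndependent.comp m hm).map_injOn
      ((Ideal.Quotient.mkₐ K P).comp (rename fun i => (v i : σ))).toLinearMap hinj.injOn

/-- The ring elements `φ i`, `i ∈ T`, separate the ideals `P i`, `i ∈ T`: `φ i` lies in all of them
except `P i`. -/
def IsSeparating (P : ι → Ideal R) (T : Finset ι) (φ : ι → R) : Prop :=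
  ∀ i ∈ T, ∀ i' ∈ T, φ i ∈ P i' ↔ i ≠ i'

theorem IsSeparating.linearIndependent_mk {T : Finset ι} {P : ι → Ideal (MvPolynomial σ K)}
    {φ : ι → MvPolynomial σ K} (hφ : IsSeparating P T φ) (hP : ∀ i ∈ T, (P i).IsPrime)
    {J : Ideal (MvPolynomial σ K)} (hJ : ∀ i ∈ T, J ≤ P i) {κ : Type*} [Finite κ]
    {u : T → κ → MvPolynomial σ K}
    (hu : ∀ i : T, LinearIndependent K fun b => Ideal.Quotient.mk (P i) (u i b)) :
    LinearIndependent K fun x : T × κ => Ideal.Quotient.mk J (φ x.1 * u x.1 x.2) := by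
  classical
  have := Fintype.ofFinite κ
  rw [linearIndependent_mk_iff]
  rintro c hc ⟨i, b⟩
  refine (linearIndependent_mk_iff.1 (hu i)) (fun b => c (i, b)) ?_ b
  -- Modulo `P i` only the terms with first index `i` survive.
  have hsum := hJ i i.2 hc
  rw [Fintype.sum_prod_type, ← Finset.add_sum_erase _ _ (Finset.mem_univ i)] at hsum
  have hother : ∑ x ∈ Finset.univ.erase i, ∑ b, c (x, b) • (φ x * u x b) ∈ P i := by
    refine Ideal.sum_mem _ fun x hx => Ideal.sum_mem _ fun b _ => ?_
    rw [smul_eq_C_mul]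
    refine Ideal.mul_mem_left _ _ (Ideal.mul_mem_right _ _ ((hφ x x.2 i i.2).2 fun h => ?_))
    exact (Finset.mem_erase.1 hx).1 (Subtype.ext h)
  have hown := (Ideal.add_mem_iff_left _ hother).1 hsum
  simp only [← mul_smul_comm, ← Finset.mul_sum] at hown
  exact ((hP i i.2).mem_or_mem hown).resolve_left fun h => (hφ i i.2 i i.2).1 h rfl

theorem IsSeparating.card_mul_le_hilbertFn [Finite σ] {T : Finset ι}
    {P : ι → Ideal (MvPolynomial σ K)} {φ : ι → MvPolynomial σ K} (hφ : IsSeparating P T φ)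
    (hP : ∀ i ∈ T, (P i).IsPrime) {J : Ideal (MvPolynomial σ K)} (hJ : ∀ i ∈ T, J ≤ P i) {n : ℕ}
    (hdim : ∀ i ∈ T, (n : WithBot ℕ∞) ≤ ringKrullDim (MvPolynomial σ K ⧸ P i)) {M : ℕ}
    (hdeg : ∀ i ∈ T, (φ i).totalDegree ≤ M) (L : ℕ) :
    T.card * (L + 1) ^ n ≤ hilbertFn J (M + n * L) := by
  choose u hu hind using fun i : T =>
    have := hP i i.2
    exists_monomials_linearIndependent (P i) (hdim i i.2) L
  simpa using card_le_hilbertFn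
    (fun x : T × (Fin n → Fin (L + 1)) =>
      (totalDegree_mul _ _).trans (Nat.add_le_add (hdeg _ x.1.2) (hu x.1 x.2)))
    (hφ.linearIndependent_mk hP hJ hind)

theorem IsSeparating.biUnion [DecidableEq ι] {P : ι → Ideal R} {Y : Finset ℕ} {lab : ι → ℕ}
    {rep : ℕ → R} {T : ℕ → Finset ι} {φ : ℕ → ι → R}
    (hP : ∀ x ∈ Y, ∀ i ∈ T x, (P i).IsPrime) (hlab : ∀ x ∈ Y, ∀ i ∈ T x, lab i = x)
    (hrep : ∀ x ∈ Y, ∀ y ∈ Y, ∀ i ∈ T y, rep x ∈ P i ↔ lab i = x)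
    (hφ : ∀ x ∈ Y, IsSeparating P (T x) (φ x)) :
    IsSeparating P (Y.biUnion T) fun i => (∏ x ∈ Y.erase (lab i), rep x) * φ (lab i) i := by
  intro i hi i' hi'
  obtain ⟨x, hx, hix⟩ := Finset.mem_biUnion.1 hi
  obtain ⟨x', hx', hix'⟩ := Finset.mem_biUnion.1 hi'
  have hPi' := hP x' hx' i' hix'
  simp only [hlab x hx i hix]
  have hprod : ∏ y ∈ Y.erase x, rep y ∈ P i' ↔ x ≠ x' := by
    simp only [hPi'.prod_mem_iff, Finset.mem_erase]
    refine ⟨?_, fun hne =>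
      ⟨x', ⟨hne.symm, hx'⟩, (hrep x' hx' x' hx' i' hix').2 (hlab x' hx' i' hix')⟩⟩
    rintro ⟨y, ⟨hyx, hyY⟩, hy⟩ rfl
    exact hyx (((hrep y hyY x hx i' hix').1 hy).symm.trans (hlab x hx i' hix'))
  rw [hPi'.mul_mem_iff_mem_or_mem, hprod]
  by_cases hxx : x = x'
  · subst hxx
    simpa using hφ x hx i hix i' hix'
  · have hne : i ≠ i' := fun h => hxx (by rw [← hlab x hx i hix, ← hlab x' hx' i' hix', h])
    simp [hxx, hne]

/-- The ideals `P i`, `i ∈ B`, label distinct branches of a tree of depth `J` with at most `G`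
children at every node: `lab j i` is the child chosen at level `j`, and `form j i'` tells this child
from its siblings, in the sense that among the `P i` with the same labels below level `j` it lies
exactly in those with `lab j i = lab j i'`. -/
structure IsTreeLabelling (P : ι → Ideal R) (B : Finset ι) (G J : ℕ) (lab : ℕ → ι → ℕ)
    (form : ℕ → ι → R) : Prop where
  lt : ∀ j < J, ∀ i ∈ B, lab j i < G
  eq_of_forall_eq : ∀ i ∈ B, ∀ i' ∈ B, (∀ j < J, lab j i = lab j i') → i = i'
  form_mem_iff : ∀ j < J, ∀ i ∈ B, ∀ i' ∈ B, (∀ j' < j, lab j' i = lab j' i') →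
    (form j i' ∈ P i ↔ lab j i = lab j i')

theorem IsTreeLabelling.tail {P : ι → Ideal R} {B : Finset ι} {G J : ℕ} {lab : ℕ → ι → ℕ}
    {form : ℕ → ι → R} (h : IsTreeLabelling P B G (J + 1) lab form) (x : ℕ) :
    IsTreeLabelling P {i ∈ B | lab 0 i = x} G J (fun j => lab (j + 1)) fun j => form (j + 1) := by
  have hagree {j : ℕ} {i i' : ι} (hi : i ∈ {i ∈ B | lab 0 i = x})
      (hi' : i' ∈ {i ∈ B | lab 0 i = x}) (hii' : ∀ j' < j, lab (j' + 1) i = lab (j' + 1) i') :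
      ∀ j' < j + 1, lab j' i = lab j' i'
    | 0, _ => (Finset.mem_filter.1 hi).2.trans (Finset.mem_filter.1 hi').2.symm
    | j' + 1, hj' => hii' j' (by omega)
  have hB {i : ι} (hi : i ∈ {i ∈ B | lab 0 i = x}) : i ∈ B := (Finset.mem_filter.1 hi).1
  exact
    { lt := fun j hj i hi => h.lt (j + 1) (by omega) i (hB hi)
      eq_of_forall_eq := fun i hi i' hi' hii' =>
        h.eq_of_forall_eq i (hB hi) i' (hB hi') (hagree hi hi' hii')
      form_mem_iff := fun j hj i hi i' hi' hii' =>
        h.form_mem_iff (j + 1) (by omega) i (hB hi) i' (hB hi') (hagree hi hi' hii') }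

theorem IsTreeLabelling.card_le {P : ι → Ideal R} {B : Finset ι} {G J : ℕ} {lab : ℕ → ι → ℕ}
    {form : ℕ → ι → R} (h : IsTreeLabelling P B G J lab form) : B.card ≤ G ^ J := by
  simpa using Finset.card_le_card_of_injOn (t := Fintype.piFinset fun _ : Fin J => Finset.range G)
    (fun i j => lab j i) (fun i hi => by simpa using fun j : Fin J => h.lt j j.2 i hi)
    fun i hi i' hi' hii' => h.eq_of_forall_eq i hi i' hi' fun j hj => congrFun hii' ⟨j, hj⟩

theorem le_card_large_fibers {B : Finset ι} {f : ι → ℕ} {G L M N : ℕ} (hf : ∀ i ∈ B, f i < G)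
    (hM : ∀ x, {i ∈ B | f i = x}.card ≤ M) (hB : G * N + L * M < B.card) :
    L ≤ {x ∈ Finset.range G | N < {i ∈ B | f i = x}.card}.card := by
  by_contra! hlt
  set Y := {x ∈ Finset.range G | N < {i ∈ B | f i = x}.card}
  refine hB.not_ge ?_
  calc B.card = ∑ x ∈ Finset.range G, {i ∈ B | f i = x}.card :=
        Finset.card_eq_sum_card_fiberwise fun i hi => by simpa using hf i hi
    _ ≤ ∑ x ∈ Finset.range G, (N + if N < {i ∈ B | f i = x}.card then M else 0) := by
        refine Finset.sum_le_sum fun x _ => ?_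
        split_ifs with h
        · exact (hM x).trans (Nat.le_add_left _ _)
        · exact not_lt.1 h
    _ = G * N + Y.card * M := by
        rw [Finset.sum_add_distrib, ← Finset.sum_filter]
        simp [Y]
    _ ≤ G * N + L * M := by gcongr

theorem IsTreeLabelling.exists_isSeparating_of_fibers {G J D M : ℕ}
    {P : ι → Ideal (MvPolynomial σ K)} {lab : ℕ → ι → ℕ} {form : ℕ → ι → MvPolynomial σ K}
    {B : Finset ι} (h : IsTreeLabelling P B G (J + 1) lab form) (hP : ∀ i ∈ B, (P i).IsPrime)
    (hdeg : ∀ i, (form 0 i).totalDegree ≤ 1) {Y : Finset ℕ} {rep : ℕ → ι}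
    (hrep : ∀ x ∈ Y, rep x ∈ {i ∈ B | lab 0 i = x}) {T : ℕ → Finset ι}
    (hTsub : ∀ x ∈ Y, T x ⊆ {i ∈ B | lab 0 i = x}) (hTcard : ∀ x ∈ Y, (T x).card = M)
    {φ : ℕ → ι → MvPolynomial σ K} (hφdeg : ∀ x ∈ Y, ∀ i ∈ T x, (φ x i).totalDegree ≤ D)
    (hφ : ∀ x ∈ Y, IsSeparating P (T x) (φ x)) :
    ∃ T' ⊆ B, T'.card = Y.card * M ∧ ∃ φ' : ι → MvPolynomial σ K,
      (∀ i ∈ T', (φ' i).totalDegree ≤ Y.card + D) ∧ IsSeparating P T' φ' := by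
  classical
  have hT : ∀ x ∈ Y, ∀ i ∈ T x, i ∈ B ∧ lab 0 i = x := fun x hx i hi =>
    Finset.mem_filter.1 (hTsub x hx hi)
  have hform : ∀ x ∈ Y, ∀ y ∈ Y, ∀ i ∈ T y, form 0 (rep x) ∈ P i ↔ lab 0 i = x := by
    intro x hx y hy i hi
    obtain ⟨hrepB, hrepx⟩ := Finset.mem_filter.1 (hrep x hx)
    rw [h.form_mem_iff 0 (by omega) i (hT y hy i hi).1 _ hrepB (by simp), hrepx]
  refine ⟨Y.biUnion T, Finset.biUnion_subset.2 fun x hx i hi => (hT x hx i hi).1, ?_,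
    fun i => (∏ x ∈ Y.erase (lab 0 i), form 0 (rep x)) * φ (lab 0 i) i, ?_,
    .biUnion (fun x hx i hi => hP i (hT x hx i hi).1) (fun x hx i hi => (hT x hx i hi).2)
      hform hφ⟩
  · rw [Finset.card_biUnion, Finset.sum_congr rfl hTcard, Finset.sum_const, smul_eq_mul]
    exact fun x hx y hy hxy => Finset.disjoint_left.2 fun i hix hiy =>
      hxy ((hT x hx i hix).2.symm.trans (hT y hy i hiy).2)
  · intro i hi
    obtain ⟨x, hx, hix⟩ := Finset.mem_biUnion.1 hi
    have hprod : (∏ y ∈ Y.erase x, form 0 (rep y)).totalDegree ≤ Y.card := by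
      refine (totalDegree_finsetProd _ _).trans ((Finset.sum_le_card_nsmul _ _ 1
        fun y _ => hdeg _).trans ?_)
      simpa using Finset.card_le_card (Finset.erase_subset x Y)
    simp only [(hT x hx i hix).2]
    exact (totalDegree_mul _ _).trans (Nat.add_le_add hprod (hφdeg x hx i hix))

theorem IsTreeLabelling.exists_isSeparating {G L J : ℕ} {P : ι → Ideal (MvPolynomial σ K)}
    {lab : ℕ → ι → ℕ} {form : ℕ → ι → MvPolynomial σ K} {B : Finset ι}
    (h : IsTreeLabelling P B G J lab form) (hP : ∀ i ∈ B, (P i).IsPrime)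
    (hdeg : ∀ j i, (form j i).totalDegree ≤ 1) (hB : J * L * G ^ (J - 1) < B.card) :
    ∃ T ⊆ B, T.card = L ^ J ∧ ∃ φ : ι → MvPolynomial σ K,
      (∀ i ∈ T, (φ i).totalDegree ≤ J * L) ∧ IsSeparating P T φ := by
  induction J generalizing lab form B with
  | zero =>
    obtain ⟨i, hi⟩ := Finset.card_pos.1 (show 0 < B.card by simpa using hB)
    refine ⟨{i}, by simpa using hi, by simp, fun _ => 1, by simp, ?_⟩
    simpa [IsSeparating] using (Ideal.ne_top_iff_one _).1 (hP i hi).ne_top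
  | succ J ih =>
    have hGJ : G * (J * L * G ^ (J - 1)) + L * G ^ J = (J + 1) * L * G ^ J := by
      cases J with
      | zero => simp
      | succ J => rw [Nat.add_sub_cancel]; ring
    obtain ⟨Y, hY, rfl⟩ := Finset.exists_subset_card_eq <|
      le_card_large_fibers (h.lt 0 (by omega)) (fun x => (h.tail x).card_le) (hGJ.trans_lt hB)
    have hlarge : ∀ x ∈ Y, J * Y.card * G ^ (J - 1) < {i ∈ B | lab 0 i = x}.card := fun x hx =>
      (Finset.mem_filter.1 (hY hx)).2
    choose! T hTsub hTcard φ hφdeg hφ using fun x (hx : x ∈ Y) =>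
      ih (h.tail x) (fun i hi => hP i (Finset.mem_filter.1 hi).1) (fun j => hdeg (j + 1))
        (hlarge x hx)
    have := (Finset.card_pos.1 ((Nat.zero_le _).trans_lt hB)).to_type
    choose! rep hrep using fun x (hx : x ∈ Y) =>
      Finset.card_pos.1 ((Nat.zero_le _).trans_lt (hlarge x hx))
    rw [pow_succ', Nat.succ_mul, Nat.add_comm (J * _)]
    exact h.exists_isSeparating_of_fibers hP (hdeg 0) hrep hTsub hTcard hφdeg hφ

end Separation

section Averaging

variable {X ι : Type*}

theorem two_pow_card_le_card_Icc_sdiff [DecidableEq X] {A F U : Finset X} {s : ℕ}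
    (hAF : A ⊆ F) (hFU : F ⊆ U) (hs : F.card ≤ s) :
    2 ^ U.card ≤ 2 ^ s * (Finset.Icc A (U \ (F \ A))).card := by
  have hle : A ⊆ U \ (F \ A) := fun x hx => by simp [hx, hFU (hAF hx)]
  rw [Finset.card_Icc_finset hle, ← pow_add,
    Finset.card_sdiff_of_subset (Finset.sdiff_subset.trans hFU), Finset.card_sdiff_of_subset hAF]
  have hA := Finset.card_le_card hAF
  have hF := Finset.card_le_card hFU
  exact Nat.pow_le_pow_right (by norm_num) (by omega)

theorem exists_card_le_inter_eq [DecidableEq X] {B : Finset ι} {own full : ι → Finset X} {s : ℕ}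
    (hsub : ∀ i ∈ B, own i ⊆ full i) (hs : ∀ i ∈ B, (full i).card ≤ s) :
    ∃ R : Finset X, ∃ B' ⊆ B, B.card ≤ 2 ^ s * B'.card ∧ ∀ i ∈ B', R ∩ full i = own i := by
  classical
  let U := B.biUnion full
  have hU {i : ι} (hi : i ∈ B) : full i ⊆ U := Finset.subset_biUnion_of_mem full hi
  -- For a fixed `i`, at least `2 ^ (|U| - s)` subsets `R` of `U` satisfy `R ∩ full i = own i`.
  let good : ι → Finset (Finset X) := fun i => Finset.Icc (own i) (U \ (full i \ own i))
  let keep : Finset X → Finset ι := fun R => {i ∈ B | R ∈ good i}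
  have hcount : ∑ R ∈ U.powerset, (keep R).card = ∑ i ∈ B, (good i).card := by
    refine (Finset.sum_card_bipartiteAbove_eq_sum_card_bipartiteBelow _).trans
      (Finset.sum_congr rfl fun i _ => ?_)
    congr 1
    ext R
    simp only [Finset.bipartiteBelow, Finset.mem_filter, Finset.mem_powerset, and_iff_right_iff_imp]
    exact fun hR => (Finset.mem_Icc.1 hR).2.trans Finset.sdiff_subset
  obtain ⟨R, -, hR⟩ : ∃ R ∈ U.powerset, B.card ≤ 2 ^ s * (keep R).card := by
    refine Finset.exists_le_of_sum_le (Finset.powerset_nonempty _) ?_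
    rw [← Finset.mul_sum, hcount, Finset.mul_sum]
    simpa [mul_comm] using Finset.sum_le_sum fun i hi =>
      two_pow_card_le_card_Icc_sdiff (hsub i hi) (hU hi) (hs i hi)
  refine ⟨R, keep R, Finset.filter_subset _ _, hR, fun i hi => ?_⟩
  obtain ⟨hiB, hiR⟩ := Finset.mem_filter.1 hi
  obtain ⟨hown, hle⟩ := Finset.mem_Icc.1 hiR
  refine Finset.Subset.antisymm (fun x hx => ?_) (Finset.subset_inter hown (hsub i hiB))
  obtain ⟨hxR, hxF⟩ := Finset.mem_inter.1 hx
  by_contra hxo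
  exact (Finset.mem_sdiff.1 (hle hxR)).2 (Finset.mem_sdiff.2 ⟨hxF, hxo⟩)

theorem exists_subset_isTreeLabelling {R : Type*} [CommRing R] {P : ι → Ideal R} {B : Finset ι}
    {G J s : ℕ} {lab : ℕ → ι → ℕ} {key : ℕ → ι → X} {f : X → R}
    (hlt : ∀ j < J, ∀ i ∈ B, lab j i < G)
    (hinj : ∀ i ∈ B, ∀ i' ∈ B, (∀ j < J, lab j i = lab j i') → i = i')
    (hkey : ∀ j < J, ∀ i ∈ B, ∀ i' ∈ B, (∀ j' ≤ j, lab j' i = lab j' i') → key j i = key j i')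
    (hlab : ∀ j < J, ∀ j' < J, ∀ i ∈ B, ∀ i' ∈ B, key j i' = key j' i → lab j i = lab j i')
    (hmem : ∀ j < J, ∀ i ∈ B, f (key j i) ∈ P i)
    (hs : ∀ i ∈ B, ∀ T : Finset X, (∀ x ∈ T, f x ∈ P i) → T.card ≤ s) :
    ∃ B' ⊆ B, B.card ≤ 2 ^ s * B'.card ∧ IsTreeLabelling P B' G J lab fun j i => f (key j i) := by
  classical
  let own : ι → Finset X := fun i => (Finset.range J).image fun j => key j i
  let full : ι → Finset X := fun i => {x ∈ B.biUnion own | f x ∈ P i}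
  have hsub : ∀ i ∈ B, own i ⊆ full i := fun i hi x hx => by
    refine Finset.mem_filter.2 ⟨Finset.mem_biUnion.2 ⟨i, hi, hx⟩, ?_⟩
    obtain ⟨j, hj, rfl⟩ := Finset.mem_image.1 hx
    exact hmem j (Finset.mem_range.1 hj) i hi
  obtain ⟨R, B', hB'B, hcard, hR⟩ := exists_card_le_inter_eq hsub fun i hi =>
    hs i hi _ fun x hx => (Finset.mem_filter.1 hx).2
  have hkey_own {j : ℕ} {i : ι} (hj : j < J) : key j i ∈ own i :=
    Finset.mem_image_of_mem _ (Finset.mem_range.2 hj)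
  refine ⟨B', hB'B, hcard, fun j hj i hi => hlt j hj i (hB'B hi),
    fun i hi i' hi' => hinj i (hB'B hi) i' (hB'B hi'), fun j hj i hi i' hi' hlow => ?_⟩
  refine ⟨fun hP => ?_, fun hji => ?_⟩
  · have hown : key j i' ∈ own i := by
      rw [← hR i hi]
      refine Finset.mem_inter.2 ⟨?_, Finset.mem_filter.2
        ⟨Finset.mem_biUnion.2 ⟨i', hB'B hi', hkey_own hj⟩, hP⟩⟩
      exact (Finset.mem_inter.1 ((hR i' hi').symm ▸ hkey_own hj)).1
    obtain ⟨j', hj', hjj'⟩ := Finset.mem_image.1 hown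
    exact hlab j hj j' (Finset.mem_range.1 hj') i (hB'B hi) i' (hB'B hi') hjj'.symm
  · rw [← hkey j hj i (hB'B hi) i' (hB'B hi') fun j' hj' =>
      hj'.lt_or_eq.elim (hlow j') fun h => h ▸ hji]
    exact hmem j hj i (hB'B hi)

end Averaging

section LinearForms

variable {K ι : Type*} [Field K] {a e : ℕ}

theorem mem_of_forall_sum_pow_smul_mem {M : Type*} [AddCommGroup M] [Module K M]
    (E : Submodule K M) {N : ℕ} {s : Fin N → K} (hs : Function.Injective s) {t : Fin N → M}
    (h : ∀ i, ∑ k : Fin N, s i ^ (k : ℕ) • t k ∈ E) (k : Fin N) : t k ∈ E := by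
  have hdet : IsUnit (Matrix.vandermonde s).det :=
    isUnit_iff_ne_zero.2 (Matrix.det_vandermonde_ne_zero_iff.2 hs)
  have hinv (l : Fin N) : ∑ i, (Matrix.vandermonde s)⁻¹ k i * s i ^ (l : ℕ) =
      (1 : Matrix (Fin N) (Fin N) K) k l := by
    rw [← Matrix.nonsing_inv_mul _ hdet]
    rfl
  have hk : t k = ∑ i, (Matrix.vandermonde s)⁻¹ k i • ∑ l : Fin N, s i ^ (l : ℕ) • t l := by
    simp_rw [Finset.smul_sum, smul_smul]
    rw [Finset.sum_comm]
    simp_rw [← Finset.sum_smul, hinv, Matrix.one_apply]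
    simp
  rw [hk]
  exact Submodule.sum_mem _ fun i _ => Submodule.smul_mem _ _ (h i)

/-- The affine form `∑ s ^ k t_k - ∑ A_j z_j - b` in the coordinates `(z, t)` of
`K ^ a × K ^ (e + 1)`. Forms with distinct parameters `s` are independent over the coordinates `z`,
so a variety of dimension above `a` lies in the zero sets of at most `e` of them. -/
def slopeForm (e : ℕ) (A : Fin a → K) (b s : K) : MvPolynomial (Fin (a + (e + 1))) K :=
  ∑ k : Fin (e + 1), C (s ^ (k : ℕ)) * X (Fin.natAdd a k) -
    ∑ j, C (A j) * X (Fin.castAdd (e + 1) j) - C b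

/-- The linear form `∑ l ^ k t_{k+1}` in the coordinates `(z, t)` of `K ^ a × K ^ (e + 1)`; it
vanishes on the subspace `t_1 = ⋯ = t_e = 0`. -/
def fiberForm (a e : ℕ) (l : K) : MvPolynomial (Fin (a + (e + 1))) K :=
  ∑ k : Fin e, C (l ^ (k : ℕ)) * X (Fin.natAdd a k.succ)

theorem eval_slopeForm (A : Fin a → K) (b s : K) (x : Fin (a + (e + 1)) → K) :
    eval x (slopeForm e A b s) = ∑ k : Fin (e + 1), s ^ (k : ℕ) * x (Fin.natAdd a k) -
      ∑ j, A j * x (Fin.castAdd (e + 1) j) - b := by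
  simp [slopeForm]

theorem eval_fiberForm (l : K) (x : Fin (a + (e + 1)) → K) :
    eval x (fiberForm a e l) = ∑ k : Fin e, l ^ (k : ℕ) * x (Fin.natAdd a k.succ) := by
  simp [fiberForm]

theorem totalDegree_sum_C_mul_X_le {σ : Type*} [Fintype ι] (r : ι → K) (v : ι → σ) :
    (∑ i, C (r i) * X (v i)).totalDegree ≤ 1 :=
  totalDegree_finsetSum_le fun _ _ => (totalDegree_mul _ _).trans (by simp)

theorem totalDegree_slopeForm_le (A : Fin a → K) (b s : K) :
    (slopeForm e A b s).totalDegree ≤ 1 :=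
  (totalDegree_sub_C_le _ _).trans <| (totalDegree_sub _ _).trans <|
    max_le (totalDegree_sum_C_mul_X_le _ _) (totalDegree_sum_C_mul_X_le _ _)

theorem totalDegree_fiberForm_le (l : K) : (fiberForm a e l).totalDegree ≤ 1 :=
  totalDegree_sum_C_mul_X_le _ _

section Quotient

variable (P : Ideal (MvPolynomial (Fin (a + (e + 1))) K))

/-- The subalgebra of `K[z, t] ⧸ P` generated by the first `a` coordinates `z`. -/
def baseSubalgebra : Subalgebra K (MvPolynomial (Fin (a + (e + 1))) K ⧸ P) :=
  ((Ideal.Quotient.mkₐ K P).comp (rename (Fin.castAdd (e + 1)))).range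

theorem ringKrullDim_le_of_mk_X_mem_baseSubalgebra
    (h : ∀ k : Fin (e + 1), Ideal.Quotient.mk P (X (Fin.natAdd a k)) ∈ baseSubalgebra P) :
    ringKrullDim (MvPolynomial (Fin (a + (e + 1))) K ⧸ P) ≤ (a : ℕ∞) := by
  have htop : baseSubalgebra P = ⊤ := by
    rw [eq_top_iff, ← adjoin_range_mk_X P, Algebra.adjoin_le_iff]
    rintro _ ⟨j, rfl⟩
    induction j using Fin.addCases with
    | left j => exact ⟨X j, by simp⟩
    | right k => exact h k
  have hle := ringKrullDim_le_of_surjective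
    ((Ideal.Quotient.mkₐ K P).comp (rename (Fin.castAdd (e + 1)))).toRingHom
    ((AlgHom.range_eq_top _).1 htop)
  rw [MvPolynomial.ringKrullDim_of_isNoetherianRing, ringKrullDim_eq_zero_of_field, zero_add,
    Nat.card_fin] at hle
  exact hle

variable {P}

theorem sum_pow_smul_mk_mem_baseSubalgebra {A : Fin a → K} {b s : K}
    (h : slopeForm e A b s ∈ P) :
    ∑ k : Fin (e + 1), s ^ (k : ℕ) • Ideal.Quotient.mk P (X (Fin.natAdd a k)) ∈
      baseSubalgebra P := by
  refine ⟨∑ j, C (A j) * X j + C b, ?_⟩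
  rw [slopeForm, sub_sub, ← Ideal.Quotient.eq] at h
  have hsmul (k : Fin (e + 1)) : s ^ (k : ℕ) • Ideal.Quotient.mk P (X (Fin.natAdd a k)) =
      Ideal.Quotient.mk P (C (s ^ (k : ℕ)) * X (Fin.natAdd a k)) := by
    rw [← smul_eq_C_mul]
    rfl
  simp only [hsmul, ← map_sum, h]
  simp

theorem card_slopeForm_mem_le {A : ι → Fin a → K} {b s : ι → K} (hs : Function.Injective s)
    (hdim : ((a + 1 : ℕ) : WithBot ℕ∞) ≤ ringKrullDim (MvPolynomial (Fin (a + (e + 1))) K ⧸ P))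
    {T : Finset ι} (hT : ∀ i ∈ T, slopeForm e (A i) (b i) (s i) ∈ P) : T.card ≤ e := by
  by_contra hlt
  obtain ⟨v⟩ : Nonempty (Fin (e + 1) ↪ T) :=
    Function.Embedding.nonempty_of_card_le (by simpa using hlt)
  have hle := hdim.trans <| ringKrullDim_le_of_mk_X_mem_baseSubalgebra P <|
    mem_of_forall_sum_pow_smul_mem (Subalgebra.toSubmodule (baseSubalgebra P))
      (hs.comp (Subtype.val_injective.comp v.injective))
      fun i => sum_pow_smul_mk_mem_baseSubalgebra (hT _ (v i).2)
  have : a + 1 ≤ a := by exact_mod_cast hle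
  omega

theorem card_fiberForm_mem_le {l : ι → K} (hl : Function.Injective l) {A : Fin a → K} {b s : K}
    (hP : slopeForm e A b s ∈ P)
    (hdim : ((a + 1 : ℕ) : WithBot ℕ∞) ≤ ringKrullDim (MvPolynomial (Fin (a + (e + 1))) K ⧸ P))
    {T : Finset ι} (hT : ∀ i ∈ T, fiberForm a e (l i) ∈ P) : T.card ≤ e := by
  by_contra! hlt
  obtain ⟨v⟩ : Nonempty (Fin e ↪ T) :=
    Function.Embedding.nonempty_of_card_le (by simpa using hlt.le)
  have hsucc : ∀ k : Fin e, Ideal.Quotient.mk P (X (Fin.natAdd a k.succ)) ∈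
      Subalgebra.toSubmodule (baseSubalgebra P) := by
    refine mem_of_forall_sum_pow_smul_mem _ (hl.comp (Subtype.val_injective.comp v.injective))
      fun i => ?_
    have hzero := Ideal.Quotient.eq_zero_iff_mem.2 (hT _ (v i).2)
    simp only [fiberForm, ← smul_eq_C_mul, ← Ideal.Quotient.mkₐ_eq_mk K, map_sum, map_smul]
      at hzero
    simpa only [Function.comp_apply, ← Ideal.Quotient.mkₐ_eq_mk K, hzero] using
      Submodule.zero_mem _
  have hzero : Ideal.Quotient.mk P (X (Fin.natAdd a 0)) ∈
      Subalgebra.toSubmodule (baseSubalgebra P) := by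
    have hsum := sum_pow_smul_mk_mem_baseSubalgebra hP
    rw [Fin.sum_univ_succ] at hsum
    simpa using (Submodule.add_mem_iff_left (Subalgebra.toSubmodule (baseSubalgebra P)) <|
      Submodule.sum_mem _ fun k _ => Submodule.smul_mem _ _ (hsucc k)).1 hsum
  have hle := hdim.trans (ringKrullDim_le_of_mk_X_mem_baseSubalgebra P (Fin.cases hzero hsucc))
  have : a + 1 ≤ a := by exact_mod_cast hle
  omega

end Quotient

end LinearForms

section LargeIntersections

/-- A branching number so large that `branching d c ^ (δ + 1)` exceeds the values of the Hilbert
function of a `δ`-dimensional variety of degree at most `c` in `ℝ ^ d` which the separation argument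
compares it with. -/
def branching (d c : ℕ) : ℕ := 2 ^ d * (2 * c + 1) ^ d * (2 * d + 1) ^ d + 1

theorem hilbertFn_bound_lt_branching_pow {d c g δ k' : ℕ} (hδ : δ ≤ d) (hg : g + 1 ≤ d)
    (hk' : k' ≤ d) (hlt : δ < g + 1 + k') :
    2 ^ d * ((2 * c + 1) ^ d * ((g + 1) * branching d c + k' * branching d c + 1) ^ δ) <
      branching d c ^ (g + 1) * (branching d c + 1) ^ k' := by
  set L := branching d c with hL
  have hL1 : 1 ≤ L := by simp [hL, branching]
  have hN : (g + 1) * L + k' * L + 1 ≤ (2 * d + 1) * L := by nlinarith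
  calc 2 ^ d * ((2 * c + 1) ^ d * ((g + 1) * L + k' * L + 1) ^ δ)
      ≤ 2 ^ d * ((2 * c + 1) ^ d * ((2 * d + 1) * L) ^ δ) := by gcongr
    _ = 2 ^ d * (2 * c + 1) ^ d * (2 * d + 1) ^ δ * L ^ δ := by rw [mul_pow]; ring
    _ ≤ 2 ^ d * (2 * c + 1) ^ d * (2 * d + 1) ^ d * L ^ δ := by gcongr; omega
    _ < L * L ^ δ := Nat.mul_lt_mul_of_pos_right (by simp [hL, branching]) (by positivity)
    _ = L ^ (δ + 1) := by ring
    _ ≤ L ^ (g + 1 + k') := Nat.pow_le_pow_right hL1 hlt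
    _ = L ^ (g + 1) * L ^ k' := pow_add _ _ _
    _ ≤ L ^ (g + 1) * (L + 1) ^ k' := by gcongr; omega

theorem mod_pow_eq_of_forall_digit_eq {G i i' J : ℕ}
    (h : ∀ j < J, i / G ^ j % G = i' / G ^ j % G) : i % G ^ J = i' % G ^ J := by
  induction J with
  | zero => simp [Nat.mod_one]
  | succ J ih =>
    rw [Nat.mod_pow_succ, Nat.mod_pow_succ, ih fun j hj => h j (by omega), h J (by omega)]

/-- The parameter of the `j`-th fiber form of the `i`-th flat: it encodes the level `j` together
with the `j`-th digit of `i` in base `G`. -/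
def fiberLabel (G j i : ℕ) : ℕ := j * G + i / G ^ j % G

theorem fiberLabel_eq_iff {G j j' i i' : ℕ} (hG : 0 < G) :
    fiberLabel G j i = fiberLabel G j' i' ↔ j = j' ∧ i / G ^ j % G = i' / G ^ j' % G := by
  refine ⟨fun h => ?_, fun ⟨hj, hi⟩ => by rw [fiberLabel, fiberLabel, hi, hj]⟩
  have hdiv := congrArg (· / G) h
  have hmod := congrArg (· % G) h
  simpa [fiberLabel, Nat.mul_add_mod', Nat.add_div_of_dvd_right, hG,
    Nat.div_eq_of_lt (Nat.mod_lt _ hG)] using And.intro hdiv hmod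

variable {a e g G : ℕ} {A : ℕ → Fin a → ℝ} {b : ℕ → ℝ} {B : Finset ℕ}

/-- The forms that may vanish on a flat, in one family: the fiber forms on the left, the slope forms
on the right. -/
def flatForm (e : ℕ) (A : ℕ → Fin a → ℝ) (b : ℕ → ℝ) : ℕ ⊕ ℕ → MvPolynomial (Fin (a + (e + 1))) ℝ :=
  Sum.elim (fun l => fiberForm a e (l : ℝ)) fun i => slopeForm e (A i) (b i) i

/-- The index in `flatForm` of the `j`-th form of the `i`-th flat, which is a fiber form for `j < g`
and the slope form for `j = g`. -/
def formIndex (g G j i : ℕ) : ℕ ⊕ ℕ := if j < g then Sum.inl (fiberLabel G j i) else Sum.inr i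

theorem totalDegree_flatForm_le (x : ℕ ⊕ ℕ) : (flatForm e A b x).totalDegree ≤ 1 :=
  match x with
  | .inl _ => totalDegree_fiberForm_le _
  | .inr _ => totalDegree_slopeForm_le _ _ _

theorem card_flatForm_mem_le {P : Ideal (MvPolynomial (Fin (a + (e + 1))) ℝ)}
    (hdim : ((a + 1 : ℕ) : WithBot ℕ∞) ≤ ringKrullDim (MvPolynomial (Fin (a + (e + 1))) ℝ ⧸ P))
    {i : ℕ} (hslope : slopeForm e (A i) (b i) i ∈ P) {T : Finset (ℕ ⊕ ℕ)}
    (hT : ∀ x ∈ T, flatForm e A b x ∈ P) : T.card ≤ 2 * e := by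
  have hleft : T.toLeft.card ≤ e := card_fiberForm_mem_le Nat.cast_injective hslope hdim
    fun l hl => hT _ (Finset.mem_toLeft.1 hl)
  have hright : T.toRight.card ≤ e := card_slopeForm_mem_le Nat.cast_injective hdim
    fun l hl => hT _ (Finset.mem_toRight.1 hl)
  rw [← Finset.card_toLeft_add_card_toRight]
  omega

theorem exists_isTreeLabelling_flatForm {P : ℕ → Ideal (MvPolynomial (Fin (a + (e + 1))) ℝ)}
    (hB : ∀ i ∈ B, i < G ^ (g + 1))
    (hdim : ∀ i ∈ B, ((a + 1 : ℕ) : WithBot ℕ∞) ≤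
      ringKrullDim (MvPolynomial (Fin (a + (e + 1))) ℝ ⧸ P i))
    (hslope : ∀ i ∈ B, slopeForm e (A i) (b i) i ∈ P i)
    (hfiber : ∀ i ∈ B, ∀ j < g, fiberForm a e (fiberLabel G j i : ℝ) ∈ P i) (hG : 0 < G) :
    ∃ B' ⊆ B, B.card ≤ 4 ^ e * B'.card ∧ IsTreeLabelling P B' G (g + 1)
      (fun j i => i / G ^ j % G) fun j i => flatForm e A b (formIndex g G j i) := by
  have hinj : ∀ i ∈ B, ∀ i' ∈ B, (∀ j < g + 1, i / G ^ j % G = i' / G ^ j % G) → i = i' := by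
    intro i hi i' hi' h
    rw [← Nat.mod_eq_of_lt (hB i hi), ← Nat.mod_eq_of_lt (hB i' hi')]
    exact mod_pow_eq_of_forall_digit_eq h
  have hindex : ∀ j < g + 1, ∀ i ∈ B, ∀ i' ∈ B,
      (∀ j' ≤ j, i / G ^ j' % G = i' / G ^ j' % G) → formIndex g G j i = formIndex g G j i' := by
    intro j hj i hi i' hi' h
    by_cases hjg : j < g
    · simp [formIndex, hjg, fiberLabel, h j le_rfl]
    · simp only [formIndex, hjg, if_false, hinj i hi i' hi' fun j' hj' => h j' (by omega)]
  have hdigit : ∀ j < g + 1, ∀ j' < g + 1, ∀ i ∈ B, ∀ i' ∈ B,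
      formIndex g G j i' = formIndex g G j' i → i / G ^ j % G = i' / G ^ j % G := by
    intro j _ j' _ i _ i' _ h
    by_cases hjg : j < g <;> by_cases hjg' : j' < g <;>
      simp only [formIndex, hjg, hjg', if_true, if_false, Sum.inl.injEq, Sum.inr.injEq,
        reduceCtorEq] at h
    · obtain ⟨rfl, h⟩ := (fiberLabel_eq_iff hG).1 h
      exact h.symm
    · rw [h]
  have hmem : ∀ j < g + 1, ∀ i ∈ B, flatForm e A b (formIndex g G j i) ∈ P i := by
    intro j _ i hi
    by_cases hjg : j < g
    · simpa [formIndex, flatForm, hjg] using hfiber i hi j hjg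
    · simpa [formIndex, flatForm, hjg] using hslope i hi
  simpa only [pow_mul, Nat.reducePow] using
    exists_subset_isTreeLabelling (fun j _ i _ => Nat.mod_lt (i / G ^ j) hG) hinj hindex hdigit hmem
      fun i hi T hT => card_flatForm_mem_le (hdim i hi) (hslope i hi) hT

theorem exists_isSeparating_of_forms_mem {P : ℕ → Ideal (MvPolynomial (Fin (a + (e + 1))) ℝ)}
    (hB : ∀ i ∈ B, i < G ^ (g + 1)) (hprime : ∀ i ∈ B, (P i).IsPrime)
    (hdim : ∀ i ∈ B, ((a + 1 : ℕ) : WithBot ℕ∞) ≤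
      ringKrullDim (MvPolynomial (Fin (a + (e + 1))) ℝ ⧸ P i))
    (hslope : ∀ i ∈ B, slopeForm e (A i) (b i) i ∈ P i)
    (hfiber : ∀ i ∈ B, ∀ j < g, fiberForm a e (fiberLabel G j i : ℝ) ∈ P i) {L : ℕ}
    (hcard : 4 ^ e * ((g + 1) * L * G ^ g) < B.card) :
    ∃ T ⊆ B, T.card = L ^ (g + 1) ∧ ∃ φ : ℕ → MvPolynomial (Fin (a + (e + 1))) ℝ,
      (∀ i ∈ T, (φ i).totalDegree ≤ (g + 1) * L) ∧ IsSeparating P T φ := by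
  obtain ⟨i₀, hi₀⟩ := Finset.card_pos.1 ((Nat.zero_le _).trans_lt hcard)
  have hG : 0 < G := Nat.pos_of_ne_zero fun h => by simpa [h] using hB i₀ hi₀
  obtain ⟨B', hB'B, hB', htree⟩ := exists_isTreeLabelling_flatForm hB hdim hslope hfiber hG
  obtain ⟨T, hTB', hT⟩ := htree.exists_isSeparating (fun i hi => hprime i (hB'B hi))
    (fun _ _ => totalDegree_flatForm_le _)
    (lt_of_mul_lt_mul_left (hcard.trans_le hB') (Nat.zero_le _))
  exact ⟨T, hTB'.trans hB'B, hT⟩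

theorem card_le_of_large_intersections {v : ℕ → Set (Fin (a + (e + 1)) → ℝ)} {c δ k' : ℕ}
    (hB : ∀ i ∈ B, i < G ^ (g + 1))
    (hslope : ∀ i ∈ B, ∀ x ∈ v i, eval x (slopeForm e (A i) (b i) (i : ℝ)) = 0)
    (hfiber : ∀ i ∈ B, ∀ x ∈ v i, ∀ j < g, eval x (fiberForm a e (fiberLabel G j i : ℝ)) = 0)
    {U : Set (Fin (a + (e + 1)) → ℝ)} (hU : IsVarietyOfDegreeLE c U) (hdim : algDim U ≤ (δ : ℕ∞))
    (hge : g ≤ e) (hδ : δ ≤ a + (e + 1)) (hk : a < k') (hk' : k' ≤ a + (e + 1))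
    (hlt : δ < g + 1 + k') (hBdim : ∀ i ∈ B, (k' : WithBot ℕ∞) ≤ algDim (v i ∩ U)) :
    B.card ≤ 4 ^ e * ((g + 1) * branching (a + (e + 1)) c * G ^ g) := by
  by_contra! hcard
  set L := branching (a + (e + 1)) c
  choose! P hprime hvP hPdim using fun i (hi : i ∈ B) =>
    exists_isPrime_le_ringKrullDim _ (hBdim i hi)
  obtain ⟨T, hTB, hTcard, φ, hφdeg, hφ⟩ := exists_isSeparating_of_forms_mem hB hprime
    (fun i hi => le_trans (by exact_mod_cast hk) (hPdim i hi))
    (fun i hi => hvP i hi (mem_vanishingIdeal_iff_eval.2 fun x hx => hslope i hi x hx.1))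
    (fun i hi j hj => hvP i hi (mem_vanishingIdeal_iff_eval.2 fun x hx => hfiber i hi x hx.1 j hj))
    hcard
  have hlow := hφ.card_mul_le_hilbertFn (fun i hi => hprime i (hTB hi))
    (fun i hi => (vanishingIdeal_anti_mono Set.inter_subset_right).trans (hvP i (hTB hi)))
    (fun i hi => hPdim i (hTB hi)) hφdeg L
  rw [hTcard] at hlow
  exact (hilbertFn_bound_lt_branching_pow hδ (by omega) hk' hlt).not_ge
    (hlow.trans (hilbertFn_variety_le hU hdim _))

end LargeIntersections

section FlatOf

variable {a g r e : ℕ} (A : Fin a → ℝ) (b s : ℝ) (l : Fin g → ℝ)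

theorem finrank_ker_add_of_surjective {N m : ℕ} {f : (Fin N → ℝ) →ₗ[ℝ] (Fin m → ℝ)}
    (hf : Function.Surjective f) : Module.finrank ℝ (LinearMap.ker f) + m = N := by
  have h := f.finrank_range_add_finrank_ker
  rw [LinearMap.range_eq_top.2 hf, finrank_top, Module.finrank_fin_fun,
    Module.finrank_fin_fun] at h
  rwa [add_comm]

/-- The point of `ℝ^a × ℝ^(e+1)` with coordinates `(z, w, 0, …, 0)`. -/
def framePoint (e : ℕ) (z : Fin a → ℝ) (w : ℝ) : Fin (a + (e + 1)) → ℝ :=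
  Fin.append z (Fin.cons w 0)

theorem framePoint_injective2 : Function.Injective2 (framePoint (a := a) e) := fun z z' w w' h =>
  ⟨funext fun j => by simpa [framePoint] using congrFun h (Fin.castAdd (e + 1) j),
    by simpa [framePoint] using congrFun h (Fin.natAdd a 0)⟩

theorem eval_slopeForm_framePoint (z : Fin a → ℝ) (w : ℝ) :
    eval (framePoint e z w) (slopeForm e A b s) = w - ∑ j, A j * z j - b := by
  rw [eval_slopeForm, Fin.sum_univ_succ]
  simp [framePoint]

theorem eval_fiberForm_framePoint (l : ℝ) (z : Fin a → ℝ) (w : ℝ) :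
    eval (framePoint e z w) (fiberForm a e l) = 0 := by
  simp [eval_fiberForm, framePoint]

/-- The linear parts of the slope form with parameters `A`, `s` and of the fiber forms with
parameters `l`. -/
def flatMap (e : ℕ) : (Fin (a + (e + 1)) → ℝ) →ₗ[ℝ] (Fin (g + 1) → ℝ) :=
  LinearMap.pi (Fin.cons
    (∑ k : Fin (e + 1), s ^ (k : ℕ) • LinearMap.proj (Fin.natAdd a k) -
      ∑ j, A j • LinearMap.proj (Fin.castAdd (e + 1) j))
    fun j => ∑ k : Fin e, l j ^ (k : ℕ) • LinearMap.proj (Fin.natAdd a k.succ))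

theorem flatMap_zero (x : Fin (a + (e + 1)) → ℝ) :
    flatMap A s l e x 0 = eval x (slopeForm e A b s) + b := by
  simp [flatMap, eval_slopeForm]

theorem flatMap_succ (x : Fin (a + (e + 1)) → ℝ) (j : Fin g) :
    flatMap A s l e x j.succ = eval x (fiberForm a e (l j)) := by
  simp [flatMap, eval_fiberForm]

variable {l} in
theorem exists_sum_pow_mul_eq (hge : g ≤ e) (hl : Function.Injective l) (c : Fin g → ℝ) :
    ∃ y : Fin e → ℝ, ∀ j, ∑ k : Fin e, l j ^ (k : ℕ) * y k = c j := by
  let q : Polynomial ℝ := Lagrange.interpolate Finset.univ l c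
  have hdeg : q.degree < e := (Lagrange.degree_interpolate_lt c hl.injOn).trans_le (by simpa)
  refine ⟨fun k => q.coeff k, fun j => ?_⟩
  rw [← Lagrange.eval_interpolate_at_node c hl.injOn (Finset.mem_univ j),
    Polynomial.eval_eq_sum_degreeLTEquiv (Polynomial.mem_degreeLT.2 hdeg)]
  exact Finset.sum_congr rfl fun k _ => mul_comm _ _

variable {l} in
theorem flatMap_surjective (hge : g ≤ e) (hl : Function.Injective l) :
    Function.Surjective (flatMap A s l e) := by
  intro c
  obtain ⟨y, hy⟩ := exists_sum_pow_mul_eq hge hl (Fin.tail c)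
  refine ⟨Fin.append 0 (Fin.cons (c 0 - ∑ k : Fin e, s ^ ((k : ℕ) + 1) * y k) y), ?_⟩
  funext j
  cases j using Fin.cases with
  | zero => simp [flatMap_zero A 0, eval_slopeForm, Fin.sum_univ_succ]
  | succ j => simpa [flatMap_succ, eval_fiberForm, Fin.tail] using hy j

/-- The flat cut out by a slope form and `g` fiber forms. -/
def flatOf (e : ℕ) : AffineSubspace ℝ (Fin (a + (e + 1)) → ℝ) :=
  AffineSubspace.mk' (framePoint e 0 b) (LinearMap.ker (flatMap A s l e))

variable {A b s l} in
theorem mem_flatOf {x : Fin (a + (e + 1)) → ℝ} : x ∈ flatOf A b s l e ↔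
    eval x (slopeForm e A b s) = 0 ∧ ∀ j, eval x (fiberForm a e (l j)) = 0 := by
  rw [flatOf, AffineSubspace.mem_mk', vsub_eq_sub, LinearMap.mem_ker, map_sub, sub_eq_zero,
    funext_iff, Fin.forall_fin_succ]
  simp [flatMap_zero A b, flatMap_succ, eval_slopeForm_framePoint, eval_fiberForm_framePoint]

variable {A b s l} in
theorem framePoint_mem_flatOf {z : Fin a → ℝ} {w : ℝ} :
    framePoint e z w ∈ flatOf A b s l e ↔ w = ∑ j, A j * z j + b := by
  simp [mem_flatOf, eval_slopeForm_framePoint, eval_fiberForm_framePoint, sub_sub, sub_eq_zero]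

variable {l} in
theorem isFlat_flatOf (hl : Function.Injective l) (he : r + g = e) :
    IsFlat (a + r) (flatOf A b s l e) := by
  refine ⟨⟨_, AffineSubspace.self_mem_mk' _ _⟩, ?_⟩
  rw [flatOf, AffineSubspace.direction_mk']
  have := finrank_ker_add_of_surjective (flatMap_surjective A s (by omega : g ≤ e) hl)
  omega

/-- The map `(z, t) ↦ (t_1, …, t_e)`. -/
def frameMap (a e : ℕ) : (Fin (a + (e + 1)) → ℝ) →ₗ[ℝ] (Fin e → ℝ) :=
  LinearMap.pi fun k => LinearMap.proj (Fin.natAdd a k.succ)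

/-- The flat `t_1 = ⋯ = t_e = 0` of `ℝ^a × ℝ^(e+1)`, which consists of all frame points. -/
def frameFlat (a e : ℕ) : AffineSubspace ℝ (Fin (a + (e + 1)) → ℝ) :=
  (LinearMap.ker (frameMap a e)).toAffineSubspace

theorem mem_frameFlat {x : Fin (a + (e + 1)) → ℝ} :
    x ∈ frameFlat a e ↔ ∀ k : Fin e, x (Fin.natAdd a k.succ) = 0 := by
  simp [frameFlat, frameMap, funext_iff]

theorem framePoint_mem_frameFlat (z : Fin a → ℝ) (w : ℝ) : framePoint e z w ∈ frameFlat a e :=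
  mem_frameFlat.2 fun k => by simp [framePoint]

theorem isFlat_frameFlat (a e : ℕ) : IsFlat (a + 1) (frameFlat a e) := by
  refine ⟨⟨_, framePoint_mem_frameFlat 0 0⟩, ?_⟩
  have hsurj : Function.Surjective (frameMap a e) := fun y =>
    ⟨Fin.append 0 (Fin.cons 0 y), by funext k; simp [frameMap]⟩
  have := finrank_ker_add_of_surjective hsurj
  rw [frameFlat, Submodule.toAffineSubspace_direction]
  omega

/-- By the Vandermonde determinant, `e` fiber forms with distinct parameters cut out the frame
flat. -/
theorem flatOf_inf_frameFlat :
    flatOf A b s l e ⊓ frameFlat a e = flatOf A b s (fun j : Fin e => (j : ℝ)) e := by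
  ext x
  rw [AffineSubspace.mem_inf_iff, mem_flatOf, mem_flatOf, mem_frameFlat]
  simp only [eval_fiberForm]
  refine ⟨fun h => ⟨h.1.1, fun j => by simp [h.2]⟩, fun h => ?_⟩
  have hx : (fun k : Fin e => x (Fin.natAdd a k.succ)) = 0 :=
    Matrix.eq_zero_of_forall_index_sum_pow_mul_eq_zero
      (Nat.cast_injective.comp Fin.val_injective) h.2
  exact ⟨⟨h.1, fun j => by simp [congrFun hx]⟩, congrFun hx⟩

theorem isFlat_flatOf_inf_frameFlat : IsFlat a (flatOf A b s l e ⊓ frameFlat a e) := by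
  rw [flatOf_inf_frameFlat]
  exact isFlat_flatOf A b s (Nat.cast_injective.comp Fin.val_injective) (zero_add e)

end FlatOf

section PolynomialRoots

variable {K : Type*} [Field K] {a : ℕ}

theorem card_le_of_forall_sum_mul_pow_succ_eq {u : Fin a → K} (hu : u ≠ 0) (w : K) {T : Finset K}
    (hT : ∀ x ∈ T, ∑ j, u j * x ^ ((j : ℕ) + 1) = w) : T.card ≤ a := by
  let Q : Polynomial K :=
    ∑ j, Polynomial.C (u j) * Polynomial.X ^ ((j : ℕ) + 1) - Polynomial.C w
  have hcoeff (j : Fin a) : Q.coeff (j + 1) = u j := by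
    simp [Q, Fin.val_inj]
  have hQ : Q ≠ 0 := fun h => hu (funext fun j => by rw [← hcoeff j, h]; simp)
  have hdeg : Q.natDegree ≤ a :=
    (Polynomial.natDegree_sub_le_of_le (Polynomial.natDegree_sum_le_of_forall_le _ _ fun j _ =>
      (Polynomial.natDegree_C_mul_X_pow_le _ _).trans j.2)
      (Polynomial.natDegree_C _).le).trans (by simp)
  refine (Polynomial.card_le_degree_of_subset_roots (p := Q) fun x hx => ?_).trans hdeg
  rw [Polynomial.mem_roots hQ, Polynomial.IsRoot.def]
  simp [Q, Polynomial.eval_finsetSum, hT x hx]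

end PolynomialRoots

section Configuration

variable {a r g p X G i i' : ℕ}

/-- The `j`-th slope of the `i`-th flat: the residue of `x ^ (j + 1)` modulo `p`, where
`x = i / (p * X)` runs through all residues. -/
def slopeNat (p X i j : ℕ) : ℕ := (i / (p * X)) ^ (j + 1) % p

/-- The `i`-th flat of the configuration. It lives in `ℝ^(a+1) × ℝ^(r+g)` and meets `ℝ^(a+1)` in
the hyperplane with slopes `slopeNat p X i` and intercept `i % (p * X)`. -/
def confFlat (a r g p X G i : ℕ) : AffineSubspace ℝ (Fin (a + (r + g + 1)) → ℝ) :=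
  flatOf (fun j : Fin a => (slopeNat p X i j : ℝ)) ((i % (p * X) : ℕ) : ℝ) (i : ℝ)
    (fun j : Fin g => (fiberLabel G j i : ℝ)) (r + g)

/-- The point of the configuration with coordinates `(z, w, 0, …, 0)`. -/
def confPoint (e : ℕ) (x : (Fin a → ℕ) × ℕ) : Fin (a + (e + 1)) → ℝ :=
  framePoint e (fun j => (x.1 j : ℝ)) x.2

/-- The parameters `(z, w)` of the points of the configuration. -/
def confGrid (a p X : ℕ) : Finset ((Fin a → ℕ) × ℕ) :=
  (Fintype.piFinset fun _ => Finset.range X) ×ˢ Finset.range ((a + 1) * (p * X))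

open Classical in
/-- The point set of the configuration, an integer grid in `ℝ^(a+1)`. -/
def confPoints (a e p X : ℕ) : Finset (Fin (a + (e + 1)) → ℝ) :=
  (confGrid a p X).image (confPoint e)

open Classical in
/-- The set of flats of the configuration. -/
def confFlats (a r g p X G : ℕ) : Finset (AffineSubspace ℝ (Fin (a + (r + g + 1)) → ℝ)) :=
  (Finset.range (p * (p * X))).image (confFlat a r g p X G)

theorem confPoint_injective {e : ℕ} : Function.Injective (confPoint (a := a) e) := by
  intro x x' h
  obtain ⟨hz, hw⟩ := framePoint_injective2 h
  exact Prod.ext (funext fun j => Nat.cast_injective (congrFun hz j)) (Nat.cast_injective hw)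

theorem card_confPoints (a e p X : ℕ) :
    (confPoints a e p X).card = X ^ a * ((a + 1) * (p * X)) := by
  rw [confPoints, Finset.card_image_of_injective _ confPoint_injective]
  simp [confGrid]

theorem confPoint_mem_confFlat {x : (Fin a → ℕ) × ℕ} :
    confPoint (r + g) x ∈ confFlat a r g p X G i ↔
      x.2 = ∑ j : Fin a, slopeNat p X i j * x.1 j + i % (p * X) := by
  rw [confPoint, confFlat, framePoint_mem_flatOf]
  norm_cast

theorem mem_confFlat {x : Fin (a + (r + g + 1)) → ℝ} : x ∈ confFlat a r g p X G i ↔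
    eval x (slopeForm (r + g) (fun j : Fin a => (slopeNat p X i j : ℝ))
      ((i % (p * X) : ℕ) : ℝ) (i : ℝ)) = 0 ∧
      ∀ j : Fin g, eval x (fiberForm a (r + g) (fiberLabel G j i : ℝ)) = 0 :=
  mem_flatOf

theorem isFlat_confFlat (hG : 0 < G) : IsFlat (a + r) (confFlat a r g p X G i) :=
  isFlat_flatOf _ _ _ (fun _ _ h => Fin.ext
    ((fiberLabel_eq_iff hG).1 (Nat.cast_injective h)).1) rfl

theorem eq_of_div_eq_of_mod_eq {M : ℕ} (hdiv : i / M = i' / M) (hmod : i % M = i' % M) :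
    i = i' := by
  rw [← Nat.div_add_mod i M, ← Nat.div_add_mod i' M, hdiv, hmod]

theorem div_mul_lt (hi : i < p * (p * X)) : i / (p * X) < p :=
  Nat.div_lt_of_lt_mul (by rwa [mul_comm (p * X)])

theorem confFlat_injOn (ha : 0 < a) :
    Set.InjOn (confFlat a r g p X G) (Finset.range (p * (p * X))) := by
  intro i hi i' hi' h
  have hmem (x : (Fin a → ℕ) × ℕ) :
      x.2 = ∑ j : Fin a, slopeNat p X i j * x.1 j + i % (p * X) ↔
        x.2 = ∑ j : Fin a, slopeNat p X i' j * x.1 j + i' % (p * X) := by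
    rw [← confPoint_mem_confFlat (r := r) (g := g) (G := G), h, confPoint_mem_confFlat]
  have hmod : i % (p * X) = i' % (p * X) := by simpa using hmem (0, i % (p * X))
  have hslope : slopeNat p X i 0 = slopeNat p X i' 0 := by
    simpa [Pi.single_apply, hmod] using
      hmem (Pi.single ⟨0, ha⟩ 1, slopeNat p X i 0 + i % (p * X))
  simp only [slopeNat, zero_add, pow_one, Nat.mod_eq_of_lt (div_mul_lt (Finset.mem_range.1 hi)),
    Nat.mod_eq_of_lt (div_mul_lt (Finset.mem_range.1 hi'))] at hslope
  exact eq_of_div_eq_of_mod_eq hslope hmod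

theorem card_confFlats (ha : 0 < a) : (confFlats a r g p X G).card = p * (p * X) := by
  classical
  rw [confFlats, Finset.card_image_of_injOn (confFlat_injOn ha), Finset.card_range]

theorem sum_slopeNat_mul_add_lt {z : Fin a → ℕ} (hz : ∀ j, z j < X) (hp : 0 < p) (hX : 0 < X) :
    ∑ j : Fin a, slopeNat p X i j * z j + i % (p * X) < (a + 1) * (p * X) := by
  have hsum : ∑ j : Fin a, slopeNat p X i j * z j ≤ ∑ _j : Fin a, p * X :=
    Finset.sum_le_sum fun j _ => Nat.mul_le_mul (Nat.mod_lt _ hp).le (hz j).le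
  calc _ < ∑ _j : Fin a, p * X + p * X := add_lt_add_of_le_of_lt hsum (Nat.mod_lt _ (by positivity))
    _ = (a + 1) * (p * X) := by simp [add_mul]

theorem card_le_incidences {d : ℕ} {ι : Type*} {P : Finset (Fin d → ℝ)}
    {V : Finset (AffineSubspace ℝ (Fin d → ℝ))} (T : Finset ι)
    (f : ι → (Fin d → ℝ) × AffineSubspace ℝ (Fin d → ℝ)) (hf : Set.InjOn f T)
    (hfT : ∀ y ∈ T, (f y).1 ∈ P ∧ (f y).2 ∈ V ∧ (f y).1 ∈ (f y).2) : T.card ≤ incidences P V := by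
  rw [← Set.ncard_coe_finset T, ← hf.ncard_image, incidences]
  refine Set.ncard_le_ncard (Set.image_subset_iff.2 hfT) ?_
  exact (P ×ˢ V).finite_toSet.subset fun e he => Finset.mem_product.2 ⟨he.1, he.2.1⟩

theorem le_incidences_conf (ha : 0 < a) (hp : 0 < p) (hX : 0 < X) :
    p * (p * X) * X ^ a ≤ incidences (confPoints a (r + g) p X) (confFlats a r g p X G) := by
  classical
  let T : Finset (ℕ × (Fin a → ℕ)) :=
    Finset.range (p * (p * X)) ×ˢ Fintype.piFinset fun _ => Finset.range X
  have hT : T.card = p * (p * X) * X ^ a := by simp [T]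
  let w : ℕ × (Fin a → ℕ) → ℕ := fun y => ∑ j : Fin a, slopeNat p X y.1 j * y.2 j + y.1 % (p * X)
  rw [← hT]
  refine card_le_incidences T
    (fun y => (confPoint (r + g) (y.2, w y), confFlat a r g p X G y.1)) ?_ fun y hy => ?_
  · intro y hy y' hy' h
    obtain ⟨hpoint, hflat⟩ := Prod.ext_iff.1 h
    exact Prod.ext
      (confFlat_injOn ha (Finset.mem_product.1 hy).1 (Finset.mem_product.1 hy').1 hflat)
      (Prod.ext_iff.1 (confPoint_injective hpoint)).1
  · obtain ⟨hi, hz⟩ := Finset.mem_product.1 hy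
    refine ⟨Finset.mem_image_of_mem _ (Finset.mem_product.2 ⟨hz, Finset.mem_range.2 ?_⟩),
      Finset.mem_image_of_mem _ hi, confPoint_mem_confFlat.2 rfl⟩
    exact sum_slopeNat_mul_add_lt (by simpa using hz) hp hX

theorem sum_mul_pow_eq_of_confPoint_mem {x : (Fin a → ℕ) × ℕ}
    (h : confPoint (r + g) x ∈ confFlat a r g p X G i) :
    (x.2 : ZMod p) = ∑ j : Fin a, (x.1 j : ZMod p) * ((i / (p * X) : ℕ) : ZMod p) ^ ((j : ℕ) + 1) +
      ((i % (p * X) : ℕ) : ZMod p) := by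
  rw [confPoint_mem_confFlat.1 h]
  simp [slopeNat, mul_comm]

theorem eq_of_confPoint_mem_of_div_eq {x : (Fin a → ℕ) × ℕ}
    (h : confPoint (r + g) x ∈ confFlat a r g p X G i)
    (h' : confPoint (r + g) x ∈ confFlat a r g p X G i') (hdiv : i / (p * X) = i' / (p * X)) :
    i = i' := by
  have h := confPoint_mem_confFlat.1 h
  have h' := confPoint_mem_confFlat.1 h'
  simp only [slopeNat, hdiv] at h h'
  exact eq_of_div_eq_of_mod_eq hdiv (by omega)

/-- The abscissae `i / (p * X)` of the flats through two points are distinct roots of a nonzero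
polynomial of degree at most `a` over `ZMod p`. -/
theorem card_le_of_confPoint_mem [Fact p.Prime] (hX : X ≤ p) {x x' : (Fin a → ℕ) × ℕ}
    (hx : ∀ j, x.1 j < X) (hx' : ∀ j, x'.1 j < X) (hne : x ≠ x') {I : Finset ℕ}
    (hI : ∀ i ∈ I, i < p * (p * X)) (h : ∀ i ∈ I, confPoint (r + g) x ∈ confFlat a r g p X G i)
    (h' : ∀ i ∈ I, confPoint (r + g) x' ∈ confFlat a r g p X G i) : I.card ≤ a := by
  obtain rfl | ⟨i₀, hi₀⟩ := I.eq_empty_or_nonempty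
  · simp
  let ρ : ℕ → ZMod p := fun i => ((i / (p * X) : ℕ) : ZMod p)
  have hρ : Set.InjOn ρ I := by
    intro i hi i' hi' hii
    refine eq_of_confPoint_mem_of_div_eq (h i hi) (h i' hi') ?_
    rwa [ZMod.natCast_eq_natCast_iff', Nat.mod_eq_of_lt (div_mul_lt (hI i hi)),
      Nat.mod_eq_of_lt (div_mul_lt (hI i' hi'))] at hii
  have hu : (fun j => (x.1 j : ZMod p) - x'.1 j) ≠ 0 := by
    intro h0
    have hz : x.1 = x'.1 := funext fun j => by
      have := sub_eq_zero.1 (congrFun h0 j)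
      rwa [ZMod.natCast_eq_natCast_iff', Nat.mod_eq_of_lt ((hx j).trans_le hX),
        Nat.mod_eq_of_lt ((hx' j).trans_le hX)] at this
    refine hne (Prod.ext hz ?_)
    rw [confPoint_mem_confFlat.1 (h i₀ hi₀), confPoint_mem_confFlat.1 (h' i₀ hi₀), hz]
  classical
  rw [← Finset.card_image_of_injOn hρ]
  refine card_le_of_forall_sum_mul_pow_succ_eq hu ((x.2 : ZMod p) - x'.2) ?_
  simp only [Finset.forall_mem_image]
  intro i hi
  rw [sum_mul_pow_eq_of_confPoint_mem (h i hi), sum_mul_pow_eq_of_confPoint_mem (h' i hi)]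
  simp [sub_mul, ρ]

theorem noBiclique_conf [Fact p.Prime] (hX : X ≤ p) :
    NoBiclique 2 (a + 1) (confPoints a (r + g) p X) (confFlats a r g p X G) := by
  classical
  intro S hS B hB hScard hBcard
  by_contra! hcon
  obtain ⟨y, y', hne, rfl⟩ := Finset.card_eq_two.1 hScard
  simp only [Finset.insert_subset_iff, Finset.singleton_subset_iff, confPoints,
    Finset.mem_image] at hS
  obtain ⟨⟨x, hx, rfl⟩, x', hx', rfl⟩ := hS
  obtain ⟨I, hI, rfl⟩ := Finset.subset_image_iff.1 hB
  have hmem {z} (hz : z ∈ confGrid a p X) (j : Fin a) : z.1 j < X := by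
    simpa using Fintype.mem_piFinset.1 (Finset.mem_product.1 hz).1 j
  have hcard := card_le_of_confPoint_mem hX (hmem hx) (hmem hx')
    (fun h => hne (congrArg _ h)) (fun i hi => Finset.mem_range.1 (hI hi))
    (fun i hi => hcon _ (by simp) _ (Finset.mem_image_of_mem _ hi))
    (fun i hi => hcon _ (by simp) _ (Finset.mem_image_of_mem _ hi))
  have := (Finset.card_image_le (s := I) (f := confFlat a r g p X G)).trans hcard
  omega

theorem lt_add_of_div_lt_div {k' δ : ℕ} (hk' : k' ≤ a + r) (hδ : 0 < δ)
    (hlt : ((a + r : ℕ) : ℚ) / ((a + (r + g + 1) : ℕ) : ℚ) < (k' : ℚ) / δ) : δ < g + 1 + k' := by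
  rw [div_lt_div_iff₀ (by positivity) (by exact_mod_cast hδ)] at hlt
  have hmul : (a + r) * δ < k' * (a + (r + g + 1)) := by exact_mod_cast hlt
  by_contra! hge
  obtain ⟨s, rfl⟩ := Nat.exists_eq_add_of_le hge
  nlinarith [Nat.mul_le_mul_right (g + 1) hk']

theorem intersectionCondition_conf {c : ℕ} (hn : p * (p * X) ≤ G ^ (g + 1)) {q : ℕ × ℕ → ℕ}
    (hq : ∀ x, x.1 ≤ a → p * (p * X) ≤ q x)
    (hq' : ∀ x, a < x.1 → 4 ^ (r + g) *
      ((g + 1) * branching (a + (r + g + 1)) c * G ^ g) ≤ q x) :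
    IntersectionCondition (a + r) c q (confFlats a r g p X G) := by
  classical
  rintro ⟨k', δ⟩ ⟨-, hk, hδ2, hδ, hlt, -⟩ U hU hdim
  dsimp only at hk hδ2 hδ hlt hdim ⊢
  let B : Finset ℕ := {i ∈ Finset.range (p * (p * X)) |
    algDim ((confFlat a r g p X G i : Set (Fin (a + (r + g + 1)) → ℝ)) ∩ U) = (k' : WithBot ℕ∞)}
  have hset : {v | v ∈ confFlats a r g p X G ∧
      algDim ((v : Set (Fin (a + (r + g + 1)) → ℝ)) ∩ U) = (k' : WithBot ℕ∞)} ⊆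
      B.image (confFlat a r g p X G) := by
    rintro v ⟨hv, hvU⟩
    obtain ⟨i, hi, rfl⟩ := Finset.mem_image.1 hv
    exact Finset.mem_image_of_mem _ (Finset.mem_filter.2 ⟨hi, hvU⟩)
  have hle := Set.ncard_le_ncard hset (Finset.finite_toSet _)
  rw [Set.ncard_coe_finset] at hle
  refine (hle.trans Finset.card_image_le).trans ?_
  have hBlt : ∀ i ∈ B, i < p * (p * X) := fun i hi => Finset.mem_range.1 (Finset.mem_filter.1 hi).1
  rcases le_or_gt k' a with hka | hka
  · exact (Finset.card_filter_le _ _).trans ((Finset.card_range _).trans_le (hq (k', δ) hka))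
  · refine le_trans ?_ (hq' (k', δ) hka)
    have hgap : δ < g + 1 + k' := lt_add_of_div_lt_div hk (by omega) hlt
    refine card_le_of_large_intersections (fun i hi => (hBlt i hi).trans_le hn)
      (v := fun i => confFlat a r g p X G i) (fun i _ x hx => (mem_confFlat.1 hx).1)
      (fun i _ x hx j hj => (mem_confFlat.1 hx).2 ⟨j, hj⟩) hU hdim.le (Nat.le_add_left g r) hδ
      hka (by omega) hgap fun i hi => ?_
    exact (Finset.mem_filter.1 hi).2.ge

end Configuration

section Weights

variable {h x : ℕ × ℕ} {τ : List (ℕ × ℕ)}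

theorem IsSignificant.tail (hs : IsSignificant (h :: τ)) : IsSignificant τ :=
  ⟨fun p hp => hs.1 p (List.mem_cons_of_mem _ hp), (List.pairwise_cons.1 hs.2).2⟩

theorem IsSignificant.getLastD_spec (hs : IsSignificant (h :: τ)) :
    1 ≤ (τ.getLastD h).1 ∧ (τ.getLastD h).1 < (τ.getLastD h).2 ∧ (τ.getLastD h).2 ≤ h.2 := by
  rcases τ.eq_nil_or_concat with rfl | ⟨σ, x, rfl⟩
  · obtain ⟨hpos, -, hlt⟩ := hs.1 h (by simp)
    exact ⟨hpos, hlt, le_rfl⟩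
  · obtain ⟨hpos, -, hlt⟩ := hs.1 x (by simp)
    simpa [hpos, hlt] using ((List.pairwise_cons.1 hs.2).1 x (by simp)).2.1.le

theorem one_div_sq_le_codimWeight_sub {d : ℕ} (hh : h.1 < h.2) (hx : x.1 < x.2) (hhd : h.2 ≤ d)
    (hxd : x.2 ≤ d) (hlt : (h.1 : ℚ) / h.2 < (x.1 : ℚ) / x.2) :
    1 / (d : ℝ) ^ 2 ≤ codimWeight x - codimWeight h := by
  have hh' : (0 : ℝ) < (h.2 : ℝ) - h.1 := sub_pos.2 (by exact_mod_cast hh)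
  have hx' : (0 : ℝ) < (x.2 : ℝ) - x.1 := sub_pos.2 (by exact_mod_cast hx)
  have hhd' : (h.2 : ℝ) ≤ d := by exact_mod_cast hhd
  have hxd' : (x.2 : ℝ) ≤ d := by exact_mod_cast hxd
  have hdet : (h.1 : ℝ) * x.2 + 1 ≤ x.1 * h.2 := by
    rw [div_lt_div_iff₀ (by exact_mod_cast hh.pos) (by exact_mod_cast hx.pos)] at hlt
    norm_cast at hlt ⊢
  have heq : codimWeight x - codimWeight h =
      ((x.1 : ℝ) * h.2 - h.1 * x.2) / (((h.2 : ℝ) - h.1) * ((x.2 : ℝ) - x.1)) := by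
    rw [codimWeight, codimWeight, div_sub_div _ _ hx'.ne' hh'.ne']
    congr 1 <;> ring
  rw [heq, sq]
  gcongr
  · linarith
  · linarith
  · exact (sub_le_self _ (Nat.cast_nonneg _)).trans hhd'
  · exact (sub_le_self _ (Nat.cast_nonneg _)).trans hxd'

theorem IsSignificant.one_div_sq_le_codimWeight_sub {d : ℕ} (hs : IsSignificant (h :: x :: τ))
    (hd : h.2 ≤ d) : 1 / (d : ℝ) ^ 2 ≤ codimWeight x - codimWeight h :=
  have hhx := (List.pairwise_cons.1 hs.2).1 x (by simp)
  FlatIncidence.one_div_sq_le_codimWeight_sub (hs.1 h (by simp)).2.2 (hs.1 x (by simp)).2.2 hd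
    (hhx.2.1.le.trans hd) hhx.2.2

theorem IsSignificant.codimWeight_sub_nonneg (hs : IsSignificant (h :: x :: τ)) :
    0 ≤ codimWeight x - codimWeight h :=
  le_trans (by positivity) (hs.one_div_sq_le_codimWeight_sub le_rfl)

theorem codimWeight_nonneg (hh : h.1 ≤ h.2) : 0 ≤ codimWeight h :=
  div_nonneg (Nat.cast_nonneg _) (sub_nonneg.2 (by exact_mod_cast hh))

/-- The exponent that the factors `q_{k_j,d_j}` contribute when `q_x` has exponent `θ x`. -/
def weightSum (θ : ℕ × ℕ → ℝ) (h : ℕ × ℕ) (τ : List (ℕ × ℕ)) : ℝ :=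
  (((h :: τ).zip τ).map fun e => (codimWeight e.2 - codimWeight e.1) * θ e.2).sum

theorem weightSum_cons (θ : ℕ × ℕ → ℝ) (h x : ℕ × ℕ) (τ : List (ℕ × ℕ)) :
    weightSum θ h (x :: τ) = (codimWeight x - codimWeight h) * θ x + weightSum θ x τ := by
  simp [weightSum]

theorem weightSum_le {θ : ℕ × ℕ → ℝ} {ν : ℝ} (hθ : ∀ x, θ x ≤ ν) (hs : IsSignificant (h :: τ)) :
    weightSum θ h τ ≤ ν * (codimWeight (τ.getLastD h) - codimWeight h) := by
  induction τ generalizing h with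
  | nil => simp [weightSum]
  | cons x τ ih =>
    have hx := mul_le_mul_of_nonneg_left (hθ x) hs.codimWeight_sub_nonneg
    have hτ := ih hs.tail
    rw [List.getLastD_cons, weightSum_cons]
    linarith

theorem weightSum_le_sub_of_mem {d : ℕ} {θ : ℕ × ℕ → ℝ} {ν η : ℝ} (hη : 0 ≤ η)
    (hθ : ∀ x, θ x ≤ ν) (hs : IsSignificant (h :: τ)) (hd : h.2 ≤ d)
    (hex : ∃ x ∈ τ, θ x ≤ ν - η) :
    weightSum θ h τ ≤ ν * (codimWeight (τ.getLastD h) - codimWeight h) - η / (d : ℝ) ^ 2 := by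
  induction τ generalizing h with
  | nil => simp at hex
  | cons x τ ih =>
    rw [List.getLastD_cons, weightSum_cons]
    by_cases hxη : θ x ≤ ν - η
    · have hgap := mul_le_mul_of_nonneg_right (hs.one_div_sq_le_codimWeight_sub hd) hη
      have hx := mul_le_mul_of_nonneg_left hxη hs.codimWeight_sub_nonneg
      have hτ := weightSum_le hθ hs.tail
      rw [one_div_mul_eq_div] at hgap
      linarith
    · have hx := mul_le_mul_of_nonneg_left (hθ x) hs.codimWeight_sub_nonneg
      have hxd := ((List.pairwise_cons.1 hs.2).1 x (by simp)).2.1.le.trans hd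
      have hτ := ih hs.tail hxd (by simpa [hxη] using hex)
      linarith

end Weights

section Terms

theorem rpow_le_rpow_mul_rpow {x c X θ w : ℝ} (hx0 : 0 ≤ x) (hc : 0 ≤ c) (hX : 0 ≤ X) (hw : 0 ≤ w)
    (hx : x ≤ c * X ^ θ) : x ^ w ≤ c ^ w * X ^ (θ * w) := by
  rw [Real.rpow_mul hX, ← Real.mul_rpow hc (by positivity)]
  exact Real.rpow_le_rpow hx0 hx hw

/-- The product `∏_{j=1}^u q_{k_j,d_j} ^ (d_j/(d_j-k_j) - d_{j-1}/(d_{j-1}-k_{j-1}))` in the term of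
the sequence `h :: τ`. -/
def parameterProd (q : ℕ × ℕ → ℕ) (h : ℕ × ℕ) (τ : List (ℕ × ℕ)) : ℝ :=
  (((h :: τ).zip τ).map fun e => (q e.2 : ℝ) ^ (codimWeight e.2 - codimWeight e.1)).prod

theorem parameterProd_cons (q : ℕ × ℕ → ℕ) (h x : ℕ × ℕ) (τ : List (ℕ × ℕ)) :
    parameterProd q h (x :: τ) =
      (q x : ℝ) ^ (codimWeight x - codimWeight h) * parameterProd q x τ := by
  simp [parameterProd]

theorem parameterProd_nonneg (q : ℕ × ℕ → ℕ) (h : ℕ × ℕ) (τ : List (ℕ × ℕ)) :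
    0 ≤ parameterProd q h τ := by
  refine List.prod_nonneg fun y hy => ?_
  obtain ⟨e, -, rfl⟩ := List.mem_map.1 hy
  positivity

theorem parameterProd_le {q : ℕ × ℕ → ℕ} {θ : ℕ × ℕ → ℝ} {c X : ℝ} (hc : 0 < c) (hX : 0 < X)
    (hq : ∀ x, (q x : ℝ) ≤ c * X ^ θ x) {h : ℕ × ℕ} {τ : List (ℕ × ℕ)}
    (hs : IsSignificant (h :: τ)) :
    parameterProd q h τ ≤
      c ^ (codimWeight (τ.getLastD h) - codimWeight h) * X ^ weightSum θ h τ := by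
  induction τ generalizing h with
  | nil => simp [parameterProd, weightSum]
  | cons x τ ih =>
    have hx := rpow_le_rpow_mul_rpow (Nat.cast_nonneg _) hc.le hX.le
      hs.codimWeight_sub_nonneg (hq x)
    rw [List.getLastD_cons, weightSum_cons, parameterProd_cons]
    refine (mul_le_mul hx (ih hs.tail) (parameterProd_nonneg ..) (by positivity)).trans_eq ?_
    rw [mul_mul_mul_comm, ← Real.rpow_add hc, ← Real.rpow_add hX, mul_comm (θ x)]
    congr 2
    ring

/-- The exponent `(d_u - k_u) / (d_u + k_u)` of the bracket in the terms for `s = 2`. -/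
def bracketExponent (l : ℕ × ℕ) : ℝ := ((l.2 : ℝ) - l.1) / (l.2 + l.1)

theorem bracketExponent_nonneg {l : ℕ × ℕ} (hl : l.1 ≤ l.2) : 0 ≤ bracketExponent l :=
  div_nonneg (sub_nonneg.2 (by exact_mod_cast hl)) (by positivity)

theorem codimWeight_mul_bracketExponent {l : ℕ × ℕ} (hl : l.1 < l.2) :
    codimWeight l * bracketExponent l = l.2 / (l.2 + l.1) := by
  have : (l.2 : ℝ) - l.1 ≠ 0 := (sub_pos.2 (by exact_mod_cast hl)).ne'
  rw [codimWeight, bracketExponent, div_mul_div_cancel₀ this]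

theorem one_div_le_bracketExponent {l : ℕ × ℕ} {d : ℕ} (hl : l.1 < l.2) (hd : l.2 ≤ d) :
    1 / (2 * (d : ℝ)) ≤ bracketExponent l := by
  have hl' : (l.1 : ℝ) + 1 ≤ l.2 := by exact_mod_cast hl
  have hd' : (l.2 : ℝ) ≤ d := by exact_mod_cast hd
  unfold bracketExponent
  gcongr <;> linarith [(Nat.cast_nonneg l.1 : (0 : ℝ) ≤ l.1)]

theorem boundTerm_two (k d : ℕ) (ε : ℝ) (m n : ℕ) (q : ℕ × ℕ → ℕ) (τ : List (ℕ × ℕ)) :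
    boundTerm 2 k d ε m n q τ =
      (m : ℝ) ^ (2 * ((τ.getLastD (k, d)).1 : ℝ) /
          ((τ.getLastD (k, d)).2 + (τ.getLastD (k, d)).1) + ε) *
        ((n : ℝ) ^ codimWeight (k, d) * parameterProd q (k, d) τ) ^
          bracketExponent (τ.getLastD (k, d)) := by
  simp only [boundTerm, parameterProd, bracketExponent]
  generalize τ.getLastD (k, d) = l
  have hden : ((2 : ℕ) : ℝ) * l.2 - l.2 + l.1 = l.2 + l.1 := by push_cast; ring
  rw [hden]
  push_cast
  norm_num

theorem boundTerm_nonneg (s k d : ℕ) (ε : ℝ) (m n : ℕ) (q : ℕ × ℕ → ℕ) (τ : List (ℕ × ℕ)) :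
    0 ≤ boundTerm s k d ε m n q τ :=
  mul_nonneg (by positivity)
    (Real.rpow_nonneg (mul_nonneg (by positivity) (parameterProd_nonneg q (k, d) τ)) _)

/-- The exponent of the term of `τ` for `s = 2`, when `m`, `n`, `q_x` have exponents `μ`, `ν`,
`θ x`. -/
def termExponent (k d : ℕ) (ε μ ν : ℝ) (θ : ℕ × ℕ → ℝ) (τ : List (ℕ × ℕ)) : ℝ :=
  (2 * ((τ.getLastD (k, d)).1 : ℝ) / ((τ.getLastD (k, d)).2 + (τ.getLastD (k, d)).1) + ε) * μ +
    (ν * codimWeight (k, d) + weightSum θ (k, d) τ) * bracketExponent (τ.getLastD (k, d))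

theorem boundTerm_two_le {k d m n : ℕ} {ε μ ν c X : ℝ} {q : ℕ × ℕ → ℕ} {θ : ℕ × ℕ → ℝ}
    {τ : List (ℕ × ℕ)} (hs : IsSignificant ((k, d) :: τ)) (hε : 0 ≤ ε) (hc : 1 ≤ c) (hX : 0 < X)
    (hm : (m : ℝ) ≤ c * X ^ μ) (hn : (n : ℝ) ≤ c * X ^ ν) (hq : ∀ x, (q x : ℝ) ≤ c * X ^ θ x) :
    boundTerm 2 k d ε m n q τ ≤ c ^ (2 + ε) * X ^ termExponent k d ε μ ν θ τ := by
  have hc0 : 0 < c := one_pos.trans_le hc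
  obtain ⟨hl0, hl, -⟩ := hs.getLastD_spec
  have hprod := parameterProd_le hc0 hX hq hs
  rw [boundTerm_two, termExponent]
  generalize τ.getLastD (k, d) = l at hl0 hl hprod
  set w := codimWeight (k, d)
  set x : ℝ := 2 * l.1 / (l.2 + l.1) + ε
  have hw : 0 ≤ w := codimWeight_nonneg (hs.1 (k, d) (by simp)).2.2.le
  have hN := rpow_le_rpow_mul_rpow (Nat.cast_nonneg n) hc0.le hX.le hw hn
  have hM := rpow_le_rpow_mul_rpow (w := x) (Nat.cast_nonneg m) hc0.le hX.le (by positivity) hm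
  have hbracket : (n : ℝ) ^ w * parameterProd q (k, d) τ ≤
      c ^ codimWeight l * X ^ (ν * w + weightSum θ (k, d) τ) := by
    refine (mul_le_mul hN hprod (parameterProd_nonneg ..) (by positivity)).trans_eq ?_
    rw [mul_mul_mul_comm, ← Real.rpow_add hc0, ← Real.rpow_add hX, add_sub_cancel]
  have hpow := rpow_le_rpow_mul_rpow (mul_nonneg (by positivity) (parameterProd_nonneg ..))
    (by positivity) hX.le (bracketExponent_nonneg hl.le) hbracket
  have hsum : x + codimWeight l * bracketExponent l ≤ 2 + ε := by
    have hden : (0 : ℝ) < l.2 + l.1 := by positivity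
    have : 2 * (l.1 : ℝ) / (l.2 + l.1) + l.2 / (l.2 + l.1) ≤ 2 := by
      rw [← add_div, div_le_iff₀ hden]
      linarith [(Nat.cast_nonneg l.2 : (0 : ℝ) ≤ l.2)]
    rw [codimWeight_mul_bracketExponent hl]
    linarith
  calc _ ≤ _ := mul_le_mul hM hpow (Real.rpow_nonneg
        (mul_nonneg (by positivity) (parameterProd_nonneg ..)) _) (by positivity)
    _ = c ^ (x + codimWeight l * bracketExponent l) *
        X ^ (x * μ + (ν * w + weightSum θ (k, d) τ) * bracketExponent l) := by
      rw [← Real.rpow_mul hc0.le, mul_mul_mul_comm, ← Real.rpow_add hc0, ← Real.rpow_add hX,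
        mul_comm μ]
    _ ≤ _ := by gcongr

theorem termExponent_le_of_weightSum_le {k d : ℕ} {ε μ ν η : ℝ} {θ : ℕ × ℕ → ℝ}
    {τ : List (ℕ × ℕ)} {l : ℕ × ℕ} (hl : τ.getLastD (k, d) = l) (hlt : l.1 < l.2)
    (hw : weightSum θ (k, d) τ ≤ ν * (codimWeight l - codimWeight (k, d)) - η) :
    termExponent k d ε μ ν θ τ ≤
      (2 * l.1 * μ + l.2 * ν) / (l.2 + l.1) + ε * μ - η * bracketExponent l := by
  have hbracket := mul_le_mul_of_nonneg_right hw (bracketExponent_nonneg hlt.le)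
  have hν : ν * codimWeight l * bracketExponent l = l.2 * ν / (l.2 + l.1) := by
    rw [mul_assoc, codimWeight_mul_bracketExponent hlt]
    ring
  rw [termExponent, hl, add_div]
  linarith [mul_div_right_comm (2 * (l.1 : ℝ)) μ (l.2 + l.1)]

end Terms

section ConfigurationExponents

variable {a g : ℕ}

/-- The exponents of the parameters `q_x` in the configuration, where `q_{a,a+1}` is removed. -/
def confExponent (a g : ℕ) (ν : ℝ) (x : ℕ × ℕ) : ℝ :=
  if x.1 ≤ a ∧ x ≠ (a, a + 1) then ν else ν - ν / (g + 1)

theorem confExponent_le {ν : ℝ} (hν : 0 ≤ ν) (x : ℕ × ℕ) : confExponent a g ν x ≤ ν := by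
  unfold confExponent
  split_ifs
  · exact le_rfl
  · exact sub_le_self _ (by positivity)

theorem mul_lt_mul_of_ne (ha : 0 < a) {x : ℕ × ℕ} (hlt : x.1 < x.2) (hx : x.1 ≤ a)
    (hne : x ≠ (a, a + 1)) : (a + 1) * x.1 < a * x.2 := by
  obtain ⟨u, v⟩ := x
  dsimp only at hlt hx ⊢
  obtain rfl | hu := hx.eq_or_lt
  · have : u + 1 < v := lt_of_le_of_ne hlt fun h => hne (by rw [h])
    rw [mul_comm]
    exact Nat.mul_lt_mul_of_pos_left this ha
  · nlinarith

theorem mul_getLastD_lt_mul (ha : 0 < a) {r : ℕ} (hr : r < a * g) {τ : List (ℕ × ℕ)}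
    (hs : IsSignificant ((a + r, a + (r + g + 1)) :: τ))
    (hτ : ∀ x ∈ τ, x.1 ≤ a ∧ x ≠ (a, a + 1)) {l : ℕ × ℕ}
    (hl : τ.getLastD (a + r, a + (r + g + 1)) = l) : (a + 1) * l.1 < a * l.2 := by
  rcases τ.eq_nil_or_concat with rfl | ⟨σ, x, rfl⟩
  · obtain rfl : _ = l := hl
    dsimp only [List.getLastD]
    nlinarith
  · obtain rfl : x = l := by simpa using hl
    exact mul_lt_mul_of_ne ha (hs.1 x (by simp)).2.2 (hτ x (by simp)).1 (hτ x (by simp)).2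

theorem mul_add_mul_div_eq {K : ℝ} {l : ℕ × ℕ} (hl : l.1 < l.2) :
    (2 * l.1 * (K + a + 1) + l.2 * (2 * K + 1)) / (l.2 + l.1 : ℝ) =
      2 * K + (2 * l.1 * (a + 1) + l.2) / (l.2 + l.1) := by
  have : (0 : ℝ) < l.2 + l.1 := by exact_mod_cast (by omega : 0 < l.2 + l.1)
  field_simp
  ring

theorem termExponent_le_of_forall {r : ℕ} (ha : 0 < a) (hr : r < a * g) {K ε : ℝ} (hK : 0 ≤ K)
    {τ : List (ℕ × ℕ)} (hs : IsSignificant ((a + r, a + (r + g + 1)) :: τ))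
    (hτ : ∀ x ∈ τ, x.1 ≤ a ∧ x ≠ (a, a + 1)) :
    termExponent (a + r) (a + (r + g + 1)) ε (K + a + 1) (2 * K + 1)
        (confExponent a g (2 * K + 1)) τ ≤
      2 * K + a + 1 - 1 / (2 * ((a + (r + g + 1) : ℕ) : ℝ)) + ε * (K + a + 1) := by
  obtain ⟨-, hlt, hld⟩ := hs.getLastD_spec
  have hweight := weightSum_le
    (confExponent_le (a := a) (g := g) (ν := 2 * K + 1) (by positivity)) hs
  generalize hl : τ.getLastD (a + r, a + (r + g + 1)) = l at hlt hld hweight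
  have hgap : ((a : ℝ) + 1) * l.1 + 1 ≤ a * l.2 := by
    exact_mod_cast mul_getLastD_lt_mul ha hr hs hτ hl
  have hterm := termExponent_le_of_weightSum_le (ε := ε) (μ := K + a + 1) (η := 0) hl hlt (by simpa)
  rw [mul_add_mul_div_eq hlt] at hterm
  have hden : (0 : ℝ) < l.2 + l.1 := by exact_mod_cast (by omega : 0 < l.2 + l.1)
  have hlast : (2 * (l.1 : ℝ) * (a + 1) + l.2) / (l.2 + l.1) ≤ a + 1 - 1 / (l.2 + l.1) := by
    rw [le_sub_iff_add_le, ← add_div, div_le_iff₀ hden]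
    linarith
  have hone : 1 / (2 * ((a + (r + g + 1) : ℕ) : ℝ)) ≤ 1 / (l.2 + l.1) :=
    one_div_le_one_div_of_le hden (by dsimp only at hld; norm_cast; omega)
  linarith

theorem termExponent_le_of_exists {r : ℕ} {K ε : ℝ}
    (hK : 2 * ((a + (r + g + 1) : ℕ) : ℝ) ^ 3 * (g + 1) ≤ K)
    {τ : List (ℕ × ℕ)} (hs : IsSignificant ((a + r, a + (r + g + 1)) :: τ))
    (hτ : ∃ x ∈ τ, ¬(x.1 ≤ a ∧ x ≠ (a, a + 1))) :
    termExponent (a + r) (a + (r + g + 1)) ε (K + a + 1) (2 * K + 1)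
        (confExponent a g (2 * K + 1)) τ ≤ 2 * K + a + ε * (K + a + 1) := by
  have hK0 : 0 ≤ K := le_trans (by positivity) hK
  obtain ⟨x, hx, hxa⟩ := hτ
  obtain ⟨-, hlt, hld⟩ := hs.getLastD_spec
  have hweight := weightSum_le_sub_of_mem (η := (2 * K + 1) / (g + 1)) (by positivity)
    (confExponent_le (a := a) (g := g) (ν := 2 * K + 1) (by positivity)) hs le_rfl
    ⟨x, hx, by rw [confExponent, if_neg hxa]⟩
  dsimp only at hld hweight
  generalize hl : τ.getLastD (a + r, a + (r + g + 1)) = l at hlt hld hweight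
  generalize a + (r + g + 1) = d at *
  have hterm := termExponent_le_of_weightSum_le (ε := ε) (μ := K + a + 1) hl hlt hweight
  rw [mul_add_mul_div_eq hlt] at hterm
  have hd : (0 : ℝ) < d := by exact_mod_cast (by omega : 0 < d)
  have hlast : (2 * (l.1 : ℝ) * (a + 1) + l.2) / (l.2 + l.1) ≤ a + 2 := by
    have hlt' : (l.1 : ℝ) ≤ l.2 := by exact_mod_cast hlt.le
    have hden : (0 : ℝ) < l.2 + l.1 := by exact_mod_cast (by omega : 0 < l.2 + l.1)
    rw [div_le_iff₀ hden]
    nlinarith [(Nat.cast_nonneg a : (0 : ℝ) ≤ a), (Nat.cast_nonneg l.1 : (0 : ℝ) ≤ l.1)]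
  have hloss : 2 ≤ (2 * K + 1) / (g + 1) / (d : ℝ) ^ 2 * bracketExponent l :=
    calc (2 : ℝ) ≤ (2 * K + 1) / (2 * (d : ℝ) ^ 3 * (g + 1)) := by
          rw [le_div_iff₀ (by positivity)]
          linarith
      _ = (2 * K + 1) / (g + 1) / (d : ℝ) ^ 2 * (1 / (2 * d)) := by field_simp
      _ ≤ _ := by gcongr; exact one_div_le_bracketExponent hlt hld
  linarith

end ConfigurationExponents

section Comparison

variable {a r g p X G K : ℕ} {ε c : ℝ}

theorem incidenceBound_nonneg (s k d : ℕ) (ε : ℝ) (m n : ℕ) (q : ℕ × ℕ → ℕ) :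
    0 ≤ incidenceBound s k d ε m n q := by
  have hterms := Finset.sum_nonneg fun τ (_ : τ ∈ (significantTails_finite k d).toFinset) =>
    boundTerm_nonneg s k d ε m n q τ
  rw [incidenceBound]
  positivity

theorem termExponent_le (ha : 0 < a) (hr : r < a * g)
    (hK : 2 * ((a + (r + g + 1) : ℕ) : ℝ) ^ 3 * (g + 1) ≤ K)
    (hε : ε * (K + a + 1) ≤ 1 / (4 * ((a + (r + g + 1) : ℕ) : ℝ))) {τ : List (ℕ × ℕ)}
    (hs : IsSignificant ((a + r, a + (r + g + 1)) :: τ)) :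
    termExponent (a + r) (a + (r + g + 1)) ε (K + a + 1) (2 * K + 1)
        (confExponent a g (2 * K + 1)) τ ≤
      2 * K + a + 1 - 1 / (4 * ((a + (r + g + 1) : ℕ) : ℝ)) := by
  have hd : (1 : ℝ) ≤ ((a + (r + g + 1) : ℕ) : ℝ) := by exact_mod_cast (by omega)
  by_cases hτ : ∀ x ∈ τ, x.1 ≤ a ∧ x ≠ (a, a + 1)
  · have hterm := termExponent_le_of_forall (ε := ε) ha hr (Nat.cast_nonneg K) hs hτ
    have hhalf : 1 / (2 * ((a + (r + g + 1) : ℕ) : ℝ)) =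
      1 / (4 * ((a + (r + g + 1) : ℕ) : ℝ)) + 1 / (4 * ((a + (r + g + 1) : ℕ) : ℝ)) := by ring
    linarith
  · have hterm := termExponent_le_of_exists (ε := ε) hK hs
      (by simpa only [not_forall, exists_prop] using hτ)
    have hsmall : 1 / (4 * ((a + (r + g + 1) : ℕ) : ℝ)) ≤ 1 / 4 :=
      one_div_le_one_div_of_le (by norm_num) (by linarith)
    linarith

theorem incidenceBound_le_of_exponents (ha : 0 < a) (hr : r < a * g)
    (hK : 2 * ((a + (r + g + 1) : ℕ) : ℝ) ^ 3 * (g + 1) ≤ K) (hε0 : 0 ≤ ε)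
    (hε : ε * (K + a + 1) ≤ 1 / (4 * ((a + (r + g + 1) : ℕ) : ℝ))) {Y : ℝ} {m n : ℕ}
    {q : ℕ × ℕ → ℕ} (hc : 1 ≤ c) (hY : 1 ≤ Y) (hm : (m : ℝ) ≤ c * Y ^ ((K : ℝ) + a + 1))
    (hn : (n : ℝ) ≤ c * Y ^ (2 * (K : ℝ) + 1))
    (hq : ∀ x, (q x : ℝ) ≤ c * Y ^ confExponent a g (2 * K + 1) x) :
    incidenceBound 2 (a + r) (a + (r + g + 1)) ε m n q ≤
      ((significantTails_finite (a + r) (a + (r + g + 1))).toFinset.card * c ^ (2 + ε) + 2 * c) *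
        Y ^ (2 * (K : ℝ) + a + 1 - 1 / (4 * ((a + (r + g + 1) : ℕ) : ℝ))) := by
  have hd1 : (1 : ℝ) ≤ (a + (r + g + 1) : ℕ) := by exact_mod_cast (by omega)
  set d := a + (r + g + 1)
  set E : ℝ := 2 * (K : ℝ) + a + 1 - 1 / (4 * (d : ℝ))
  have hmono {x : ℝ} (hx : x ≤ E) {y : ℝ} (hy : 0 ≤ y) : y * Y ^ x ≤ y * Y ^ E :=
    mul_le_mul_of_nonneg_left (Real.rpow_le_rpow_of_exponent_le hY hx) hy
  have hsum := Finset.sum_le_card_nsmul (significantTails_finite (a + r) d).toFinset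
    (boundTerm 2 (a + r) d ε m n q) (c ^ (2 + ε) * Y ^ E) fun τ hτ => by
      have hs : IsSignificant ((a + r, d) :: τ) :=
        (significantTails_finite (a + r) d).mem_toFinset.1 hτ
      exact (boundTerm_two_le hs hε0 hc (by positivity) hm hn hq).trans
        (hmono (termExponent_le ha hr hK hε hs) (by positivity))
  have ha1 : (1 : ℝ) ≤ a := by exact_mod_cast ha
  have hK1 : (1 : ℝ) ≤ K := by
    refine le_trans ?_ hK
    nlinarith [one_le_pow₀ hd1 (n := 3), (Nat.cast_nonneg g : (0 : ℝ) ≤ g)]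
  have hsmall : 1 / (4 * (d : ℝ)) ≤ 1 := by
    rw [div_le_one (by positivity)]
    linarith
  have hm' := hm.trans (hmono (by linarith) (by positivity))
  have hn' := hn.trans (hmono (by linarith) (by positivity))
  rw [nsmul_eq_mul] at hsum
  rw [incidenceBound]
  linarith

theorem exists_le_pow_succ {n : ℕ} (hn : 0 < n) (g : ℕ) :
    ∃ G : ℕ, n ≤ G ^ (g + 1) ∧ ((G ^ g : ℕ) : ℝ) ≤ 2 ^ g * (n : ℝ) ^ ((g : ℝ) / (g + 1)) := by
  have hn1 : (1 : ℝ) ≤ n := by exact_mod_cast hn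
  set y : ℝ := (n : ℝ) ^ (1 / ((g : ℝ) + 1)) with hy
  have hy1 : 1 ≤ y := Real.one_le_rpow hn1 (by positivity)
  have hpow (j : ℕ) : y ^ j = (n : ℝ) ^ ((j : ℝ) / (g + 1)) := by
    rw [hy, ← Real.rpow_natCast, ← Real.rpow_mul (by positivity), one_div_mul_eq_div]
  refine ⟨⌈y⌉₊, ?_, ?_⟩
  · have hroot : y ^ (g + 1) = n := by
      rw [hpow, Nat.cast_succ, div_self (by positivity), Real.rpow_one]
    have hle : (n : ℝ) ≤ (⌈y⌉₊ : ℝ) ^ (g + 1) :=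
      hroot.symm.trans_le (by gcongr; exact Nat.le_ceil y)
    exact_mod_cast hle
  · have hceil : (⌈y⌉₊ : ℝ) ≤ 2 * y := by
      linarith [Nat.ceil_lt_add_one (zero_le_one.trans hy1)]
    push_cast
    rw [← hpow, ← mul_pow]
    gcongr

theorem exists_le_pow_succ_of_le {n : ℕ} (hn : 0 < n) {Y ν : ℝ} (hY : 0 ≤ Y) (hc : 1 ≤ c)
    (hnY : (n : ℝ) ≤ c * Y ^ ν) (g : ℕ) :
    ∃ G : ℕ, n ≤ G ^ (g + 1) ∧ ((G ^ g : ℕ) : ℝ) ≤ 2 ^ g * c * Y ^ (ν - ν / (g + 1)) := by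
  obtain ⟨G, hG, hGg⟩ := exists_le_pow_succ hn g
  have hg : (g : ℝ) / (g + 1) ≤ 1 := by
    rw [div_le_one (by positivity)]
    linarith
  have hexp : ν * ((g : ℝ) / (g + 1)) = ν - ν / (g + 1) := by
    field_simp
    ring
  have hpow := rpow_le_rpow_mul_rpow (w := (g : ℝ) / (g + 1)) (Nat.cast_nonneg n) (by positivity)
    hY (by positivity) hnY
  rw [hexp] at hpow
  refine ⟨G, hG, hGg.trans ?_⟩
  rw [mul_assoc]
  gcongr
  refine hpow.trans ?_
  gcongr
  exact (Real.rpow_le_rpow_of_exponent_le hc hg).trans_eq (Real.rpow_one c)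

theorem update_ite_le_rpow_confExponent {N Q : ℕ} {Y ν : ℝ} (hc : 1 ≤ c) (hY : 1 ≤ Y) (hν : 0 ≤ ν)
    (hN : (N : ℝ) ≤ c * Y ^ ν) (hQ : (Q : ℝ) ≤ c * Y ^ (ν - ν / (g + 1))) (x : ℕ × ℕ) :
    ((Function.update (fun x => if x.1 ≤ a then N else Q) (a, a + 1) 1 x : ℕ) : ℝ) ≤
      c * Y ^ confExponent a g ν x := by
  unfold confExponent
  by_cases hx : x = (a, a + 1)
  · have hν' : 0 ≤ ν - ν / ((g : ℝ) + 1) := sub_nonneg.2 (div_le_self hν (by simp))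
    rw [hx, Function.update_self, if_neg (by simp), Nat.cast_one]
    exact one_le_mul_of_one_le_of_one_le hc (Real.one_le_rpow hY hν')
  · rw [Function.update_of_ne hx]
    by_cases hxa : x.1 ≤ a
    · simpa [hx, hxa] using hN
    · simpa [hxa] using hQ

theorem card_confFlats_le (hp : p ≤ 2 * X ^ K) :
    ((p * (p * X) : ℕ) : ℝ) ≤ 4 * (X : ℝ) ^ (2 * (K : ℝ) + 1) := by
  have h : p * (p * X) ≤ 4 * X ^ (2 * K + 1) :=
    calc _ ≤ 2 * X ^ K * (2 * X ^ K * X) := by gcongr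
      _ = _ := by ring
  rw [show 2 * (K : ℝ) + 1 = ((2 * K + 1 : ℕ) : ℝ) by push_cast; rfl, Real.rpow_natCast]
  exact_mod_cast h

theorem card_confPoints_le {e : ℕ} (hp : p ≤ 2 * X ^ K) :
    ((confPoints a e p X).card : ℝ) ≤ 2 * (a + 1) * (X : ℝ) ^ ((K : ℝ) + a + 1) := by
  have h : X ^ a * ((a + 1) * (p * X)) ≤ 2 * (a + 1) * X ^ (K + a + 1) :=
    calc _ ≤ X ^ a * ((a + 1) * (2 * X ^ K * X)) := by gcongr
      _ = _ := by ring
  rw [card_confPoints, show (K : ℝ) + a + 1 = ((K + a + 1 : ℕ) : ℝ) by push_cast; rfl,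
    Real.rpow_natCast]
  exact_mod_cast h

theorem rpow_le_incidences (ha : 0 < a) (hp : X ^ K ≤ p) (hX : 0 < X) :
    (X : ℝ) ^ (2 * (K : ℝ) + a + 1) ≤
      (incidences (confPoints a (r + g) p X) (confFlats a r g p X G) : ℝ) := by
  have h : X ^ (2 * K + a + 1) ≤ p * (p * X) * X ^ a :=
    calc _ = X ^ K * (X ^ K * X) * X ^ a := by ring
      _ ≤ _ := by gcongr
  rw [show 2 * (K : ℝ) + a + 1 = ((2 * K + a + 1 : ℕ) : ℝ) by push_cast; rfl, Real.rpow_natCast]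
  exact_mod_cast h.trans (le_incidences_conf ha ((pow_pos hX K).trans_le hp) hX)

theorem mul_lt_of_le_mul_rpow_sub {C B Y δ E I : ℝ} (hY : 0 < Y) (hB0 : 0 ≤ B)
    (hB : B ≤ c * Y ^ (E - δ)) (hC : |C| * c < Y ^ δ) (hI : Y ^ E ≤ I) : C * B < I :=
  calc C * B ≤ |C| * B := mul_le_mul_of_nonneg_right (le_abs_self C) hB0
    _ ≤ |C| * (c * Y ^ (E - δ)) := mul_le_mul_of_nonneg_left hB (abs_nonneg C)
    _ = |C| * c * Y ^ (E - δ) := (mul_assoc ..).symm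
    _ < Y ^ δ * Y ^ (E - δ) := mul_lt_mul_of_pos_right hC (by positivity)
    _ = Y ^ E := by rw [← Real.rpow_add hY, add_sub_cancel]
    _ ≤ I := hI

theorem exists_configuration (ha : 0 < a) (hr : r < a * g)
    (hK : 2 * ((a + (r + g + 1) : ℕ) : ℝ) ^ 3 * (g + 1) ≤ K) (hε0 : 0 ≤ ε)
    (hε : ε * (K + a + 1) ≤ 1 / (4 * ((a + (r + g + 1) : ℕ) : ℝ))) (c : ℕ) (C : ℝ) :
    ∃ (p X G : ℕ) (q : ℕ × ℕ → ℕ), p.Prime ∧ X ≤ p ∧ 0 < G ∧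
      IntersectionCondition (a + r) c q (confFlats a r g p X G) ∧
      C * incidenceBound 2 (a + r) (a + (r + g + 1)) ε (confPoints a (r + g) p X).card
        (confFlats a r g p X G).card (Function.update q (a, a + 1) 1) <
          (incidences (confPoints a (r + g) p X) (confFlats a r g p X G) : ℝ) := by
  set d := a + (r + g + 1)
  set b := 4 ^ (r + g) * ((g + 1) * branching d c) with hb
  obtain ⟨c₁, hc₁, hc₁a, hc₁b⟩ :
      ∃ c₁ : ℝ, 4 ≤ c₁ ∧ 2 * ((a : ℝ) + 1) ≤ c₁ ∧ b * (2 ^ g * 4) ≤ c₁ :=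
    ⟨max 4 (max (2 * (a + 1)) (b * (2 ^ g * 4))), by simp⟩
  obtain ⟨X, hX, hXC⟩ := ((Filter.eventually_ge_atTop 1).and
    (((tendsto_rpow_atTop (y := 1 / (4 * (d : ℝ))) (by positivity)).comp
      tendsto_natCast_atTop_atTop).eventually_gt_atTop (|C| *
        ((significantTails_finite (a + r) d).toFinset.card * c₁ ^ (2 + ε) + 2 * c₁)))).exists
  have hX1 : (1 : ℝ) ≤ X := by exact_mod_cast hX
  obtain ⟨p, hp, hXp, hpX⟩ := Nat.exists_prime_lt_and_le_two_mul (X ^ K) (by positivity)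
  have hn : 0 < p * (p * X) := by have := hp.pos; positivity
  have hflats := card_confFlats_le hpX
  obtain ⟨G, hG, hGg⟩ := exists_le_pow_succ_of_le hn (by positivity) (by norm_num) hflats g
  have hK0 : K ≠ 0 := by
    rintro rfl
    exact absurd hK (not_le.2 (by rw [Nat.cast_zero]; positivity))
  have hQ : ((b * G ^ g : ℕ) : ℝ) ≤
      b * (2 ^ g * 4) * (X : ℝ) ^ (2 * (K : ℝ) + 1 - (2 * K + 1) / (g + 1)) := by
    rw [Nat.cast_mul, mul_assoc]
    exact mul_le_mul_of_nonneg_left hGg (Nat.cast_nonneg b)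
  refine ⟨p, X, G, fun x => if x.1 ≤ a then p * (p * X) else b * G ^ g, hp,
    (Nat.le_self_pow hK0 X).trans hXp.le, Nat.pos_of_ne_zero fun h => ?_,
    intersectionCondition_conf hG (fun x hx => (if_pos hx).ge) fun x hx => ?_,
    mul_lt_of_le_mul_rpow_sub (by positivity) (incidenceBound_nonneg ..)
      (incidenceBound_le_of_exponents ha hr hK hε0 hε (by linarith) hX1 ?_ ?_
        (update_ite_le_rpow_confExponent (by linarith) hX1 (by positivity) ?_ ?_)) hXC
      (rpow_le_incidences ha hXp.le hX)⟩
  · simp [h, hn.ne'] at hG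
  · rw [if_neg hx.not_ge, hb]
    exact le_of_eq (by ring)
  · exact (card_confPoints_le hpX).trans (by gcongr)
  · rw [card_confFlats ha]
    exact hflats.trans (by gcongr)
  · exact hflats.trans (by gcongr)
  · exact hQ.trans (by gcongr)

theorem exists_dims_of_ratio_lt {k d d' : ℕ} (hd : 0 < d) (hd' : 0 < d')
    (hratio : (k : ℝ) / d < ((d' : ℝ) - 1) / d') (hle : d' - 1 ≤ k) :
    ∃ a r g : ℕ, 0 < a ∧ r < a * g ∧ d' = a + 1 ∧ k = a + r ∧ d = a + (r + g + 1) := by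
  obtain ⟨a, rfl⟩ := Nat.exists_eq_add_of_le' hd'
  obtain ⟨r, rfl⟩ := Nat.exists_eq_add_of_le hle
  rw [div_lt_div_iff₀ (by exact_mod_cast hd) (by exact_mod_cast hd')] at hratio
  push_cast [Nat.add_sub_cancel, add_sub_cancel_right] at hratio
  have hmul : (a + r) * (a + 1) < a * d := by exact_mod_cast hratio
  have hlt : a + r < d := by
    by_contra! hge
    nlinarith [Nat.mul_le_mul_left a hge]
  obtain ⟨g, rfl⟩ := Nat.exists_eq_add_of_lt hlt
  exact ⟨a, r, g, Nat.pos_of_ne_zero (by rintro rfl; simp at hmul), by nlinarith, rfl, by simp,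
    by ring⟩

end Comparison

end FlatIncidence

end

open FlatIncidence in
/-- In the incidence bound for `k`-flats in `ℝ^d` and `s = 2`, the parameter `q_{d'-1,d'}` is
replaced by `1` in every term; the bound so obtained fails. For some `t` and all small `ε`, no choice
of the constants `c` and `C` makes it valid: there are `m` points in a `d'`-flat `F`, and `n`
`k`-flats meeting `F` in `(d'-1)`-flats, that satisfy all hypotheses of the incidence bound and
violate it. -/
theorem theorem1p4 (k d d' : ℕ) (hk : 0 < k) (hd : 0 < d) (hd' : 0 < d')
    (hratio : (k : ℝ) / d < ((d' : ℝ) - 1) / d') (hle : d' - 1 ≤ k) :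
    ∃ t : ℕ, 0 < t ∧ ∃ ε₀ : ℝ, 0 < ε₀ ∧ ∀ ε : ℝ, 0 < ε → ε ≤ ε₀ → ∀ (c : ℕ) (C : ℝ),
      ∃ (P : Finset (Fin d → ℝ)) (V : Finset (AffineSubspace ℝ (Fin d → ℝ)))
        (q : ℕ × ℕ → ℕ) (F : AffineSubspace ℝ (Fin d → ℝ)),
        (∀ v ∈ V, IsFlat k v) ∧
        NoBiclique 2 t P V ∧
        IntersectionCondition k c q V ∧
        IsFlat d' F ∧ (∀ p ∈ P, p ∈ F) ∧ (∀ v ∈ V, IsFlat (d' - 1) (v ⊓ F)) ∧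
        C * incidenceBound 2 k d ε P.card V.card (Function.update q (d' - 1, d') 1) <
          (incidences P V : ℝ) := by
  obtain ⟨a, r, g, ha, hr, rfl, rfl, rfl⟩ := exists_dims_of_ratio_lt hd hd' hratio hle
  set K : ℕ := 2 * (a + (r + g + 1)) ^ 3 * (g + 1) with hK
  refine ⟨a + 1, by omega, 1 / (4 * ((a + (r + g + 1) : ℕ) : ℝ)) / (K + a + 1),
    by positivity, fun ε hε0 hε c C => ?_⟩
  obtain ⟨p, X, G, q, hp, hXp, hG, hI, hlt⟩ := exists_configuration ha hr
    (K := K) (by exact_mod_cast hK.ge) hε0.le ((le_div_iff₀ (by positivity)).1 hε) c C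
  have := Fact.mk hp
  refine ⟨confPoints a (r + g) p X, confFlats a r g p X G, q, frameFlat a (r + g), ?_,
    noBiclique_conf hXp, hI, isFlat_frameFlat a (r + g), ?_, ?_, hlt⟩
  all_goals classical simp only [confFlats, confPoints, Finset.forall_mem_image]
  · exact fun _ _ => isFlat_confFlat hG
  · exact fun _ _ => framePoint_mem_frameFlat ..
  · exact fun _ _ => isFlat_flatOf_inf_frameFlat ..
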